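/- Let $M\in\mathbb N$, $n_1,\dots,n_M\ge 1$ and $X=\prod_{m=1}^M S^{n_m}$, a product of round unit spheres. For integers $n\ge1$, $\ell\ge 0$ let $E(n,\ell)$ be the eigenspace $\{f\in C^\infty(S^n): -\Delta_{S^n}f=\ell(\ell+n-1)f\}$, let $D(n,\ell)=\dim E(n,\ell)$, fix an $L^2(S^n)$-orthonormal basis $f_1,\dots,f_{D}$ of $E(n,\ell)$, and let $\varphi_{n,\ell}=(|S^n|/D)^{1/2}(f_1,\dots,f_{D}):S^n\to\mathbb R^{D(n,\ell)}$ be the corresponding higher Veronese map. For $\vec\ell\in\mathbb N_0^M$ put $\varphi_{\vec\ell}(x_1,\dots,x_M)=\bigotimes_{m=1}^M\varphi_{n_m,\ell_m}(x_m)\in\mathbb R^{L(\vec\ell)}$, where $L(\vec\ell)=\prod_m D(n_m,\ell_m)$. Put $$\rho(n,\ell)=\frac{\ell(\ell+n-1)}{n},\qquad \lambda(n,\ell)=\frac{3n}{n+2}\,\rho(n,\ell)^2-\frac{2(n-1)}{n+2}\,\rho(n,\ell),$$ and $\rho_m(\vec\ell)=\rho(n_m,\ell_m)$, $\lambda_m(\vec\ell)=\lambda(n_m,\ell_m)$.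 Let $\mu=\sum_{\vec\ell\in\mathbb N_0^M}\alpha(\vec\ell)\,\delta_{\vec\ell}$ be a probability measure on $\mathbb N_0^M$ with finite support, let $\mathbb E$ be the expectation with respect to $\mu$, and assume $\mathbb E[\rho_m]>0$ for $m=1,\dots,M$. Define $$F:X\to\mathbb R^N,\qquad F(x)=\bigoplus_{\vec\ell\in\operatorname{supp}\alpha}\alpha(\vec\ell)^{1/2}\varphi_{\vec\ell}(x),\qquad N=\sum_{\vec\ell\in\operatorname{supp}\alpha}L(\vec\ell).$$ Let $G\in\mathbb R^M$ have entries $G_m=\mathbb E[\rho_m]$, and let $A$ be the symmetric $M\times M$ matrix with $A_{mm}=\mathbb E[\lambda_m]$ and $A_{ab}=3\,\mathbb E[\rho_a\rho_b]$ for $a\ne b$. A symmetric matrix $B$ is copositive if $U^TBU\ge0$ for all $U\in\mathbb R^M$ with nonnegative entries. Then $|F(x)|=1$ for all $x\in X$ and $F$ is a smooth immersion into $\mathbb R^N$ (so an immersion of $X$ into the closed unit ball, with image in the unit sphere). Moreover there is a smallest $s\ge0$ such that $B(s)=sGG^T-A$ is copositive, and for this $s$ the maximal normal curvature of $F$ is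 $$\mathfrak c(F)=\sup_{|u|=1}|\mathbf A_F(u,u)|=\sqrt s,$$ where $\mathbf A_F$ is the second fundamental form of $F$ as an immersion into $\mathbb R^N$ and the supremum is over all tangent vectors $u$ of $X$ of length $1$ for the pullback metric $F^*g_{\mathbb R^N}$. -/

import Mathlib

open MeasureTheory Manifold InnerProductSpace
open scoped ContDiff Manifold

noncomputable section

namespace VeroneseProduct

/-! ### Second fundamental form and normal curvature of an immersion into Euclidean space -/

section Curvature

variable {E : Type*} [NormedAddCommGroup E] [NormedSpace ℝ E]
  {H : Type*} [TopologicalSpace H] (I : ModelWithCorners ℝ E H)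
  {X : Type*} [TopologicalSpace X] [ChartedSpace H X]
  {V : Type*} [NormedAddCommGroup V] [InnerProductSpace ℝ V] [FiniteDimensional ℝ V]

/-- The differential `df_p : T_p X → V` of a map `f` from a manifold into a Euclidean space.
As always in Mathlib, `T_p X` is identified with the model vector space `E` through the preferred
chart at `p`. -/
def differential (f : X → V) (p : X) : E →L[ℝ] V := mfderiv I 𝓘(ℝ, V) f p

/-- The second fundamental form `𝐀(u, u)` of `f` at `p`: the component of the second derivative
`D²f(u, u)`, computed in the preferred chart at `p`, which is normal to `df_p (T_p X)`.
(A different chart changes the second derivative by a tangential term only.) -/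
def secondFundamentalForm (f : X → V) (p : X) (u : E) : V :=
  ((differential I f p).range)ᗮ.starProjection
    (iteratedFDerivWithin ℝ 2 (f ∘ (extChartAt I p).symm) (Set.range I) (extChartAt I p p)
      ![u, u])

/-- The maximal normal curvature `𝔠(f) = sup |𝐀(u, u)|` over all tangent vectors `u` at all points
which are unit vectors for the pullback metric `f^* g`, i.e. `|df_p u| = 1`. -/
def normalCurvature (f : X → V) : ENNReal :=
  ⨆ (p : X) (u : E) (_ : ‖differential I f p u‖ = 1), ‖secondFundamentalForm I f p u‖ₑ

end Curvature

/-! ### Laplace eigenfunctions on the round sphere and higher Veronese maps -/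

/-- The unit sphere `S^n` in `ℝ^(n+1)`. -/
abbrev Sph (n : ℕ) : Type := Metric.sphere (0 : EuclideanSpace ℝ (Fin (n + 1))) 1

/-- The extension of a function on `S^n` to `ℝ^(n+1)` which is constant along open rays from the
origin (with value `0` at the origin). -/
def radialExtension {n : ℕ} (f : Sph n → ℝ) (y : EuclideanSpace ℝ (Fin (n + 1))) : ℝ :=
  if hy : y = 0 then 0 else f ⟨‖y‖⁻¹ • y, by simp [norm_smul, hy]⟩

/-- The Laplace operator of the round metric on `S^n` (with the sign for which it is nonpositive):
the restriction to `S^n` of the Euclidean Laplacian of the radially constant extension. -/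
def sphereLaplacian {n : ℕ} (f : Sph n → ℝ) (x : Sph n) : ℝ :=
  Laplacian.laplacian (radialExtension f) (x : EuclideanSpace ℝ (Fin (n + 1)))

lemma contDiffAt_radialExtension {n : ℕ} {f : Sph n → ℝ} (hf : ContMDiff (𝓡 n) 𝓘(ℝ, ℝ) ∞ f)
    {y : EuclideanSpace ℝ (Fin (n + 1))} (hy : y ≠ 0) :
    ContDiffAt ℝ ∞ (radialExtension f) y := by
  have := Fact.mk (finrank_euclideanSpace_fin (𝕜 := ℝ) (n := n + 1))
  let W : TopologicalSpace.Opens (EuclideanSpace ℝ (Fin (n + 1))) := ⟨{0}ᶜ, isOpen_compl_singleton⟩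
  have hne : ∀ z : W, (z : EuclideanSpace ℝ (Fin (n + 1))) ≠ 0 := fun z => z.2
  have h1 : ContMDiff 𝓘(ℝ, EuclideanSpace ℝ (Fin (n + 1)))
      𝓘(ℝ, EuclideanSpace ℝ (Fin (n + 1))) ∞
      (fun z : W => ‖(z : EuclideanSpace ℝ (Fin (n + 1)))‖⁻¹ •
        (z : EuclideanSpace ℝ (Fin (n + 1)))) := by
    intro z
    refine (contMDiffAt_subtype_iff (U := W)
      (f := fun z : EuclideanSpace ℝ (Fin (n + 1)) => ‖z‖⁻¹ • z)).2 ?_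
    exact ((((contDiffAt_norm ℝ (hne z)).inv (norm_ne_zero_iff.2 (hne z)))).smul
      contDiffAt_id).contMDiffAt
  have hmem : ∀ z : W, ‖(z : EuclideanSpace ℝ (Fin (n + 1)))‖⁻¹ •
      (z : EuclideanSpace ℝ (Fin (n + 1))) ∈
        Metric.sphere (0 : EuclideanSpace ℝ (Fin (n + 1))) 1 := fun z => by
    simp [norm_smul, hne z]
  have h2 := hf.comp (h1.codRestrict_sphere (n := n) hmem)
  have h3 := (h2 ⟨y, hy⟩)
  rw [← contMDiffAt_iff_contDiffAt]
  refine (contMDiffAt_subtype_iff (U := W) (x := ⟨y, hy⟩)).1 ?_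
  refine h3.congr_of_eventuallyEq (Filter.Eventually.of_forall fun z => ?_)
  simp only [radialExtension, hne z, dite_false, Function.comp_apply]
  rfl

lemma radialExtension_add {n : ℕ} (f g : Sph n → ℝ) :
    radialExtension (f + g) = radialExtension f + radialExtension g := by
  ext y
  by_cases hy : y = 0 <;> simp [radialExtension, hy]

lemma radialExtension_smul {n : ℕ} (c : ℝ) (f : Sph n → ℝ) :
    radialExtension (c • f) = c • radialExtension f := by
  ext y
  by_cases hy : y = 0 <;> simp [radialExtension, hy]

lemma sphereLaplacian_add {n : ℕ} {f g : Sph n → ℝ} (hf : ContMDiff (𝓡 n) 𝓘(ℝ, ℝ) ∞ f)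
    (hg : ContMDiff (𝓡 n) 𝓘(ℝ, ℝ) ∞ g) (x : Sph n) :
    sphereLaplacian (f + g) x = sphereLaplacian f x + sphereLaplacian g x := by
  have hx : (x : EuclideanSpace ℝ (Fin (n + 1))) ≠ 0 := ne_zero_of_mem_unit_sphere x
  rw [sphereLaplacian, radialExtension_add]
  exact (contDiffAt_infty.1 (contDiffAt_radialExtension hf hx) 2).laplacian_add
    (contDiffAt_infty.1 (contDiffAt_radialExtension hg hx) 2)

lemma sphereLaplacian_smul {n : ℕ} (c : ℝ) {f : Sph n → ℝ} (hf : ContMDiff (𝓡 n) 𝓘(ℝ, ℝ) ∞ f)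
    (x : Sph n) : sphereLaplacian (c • f) x = c * sphereLaplacian f x := by
  have hx : (x : EuclideanSpace ℝ (Fin (n + 1))) ≠ 0 := ne_zero_of_mem_unit_sphere x
  rw [sphereLaplacian, radialExtension_smul]
  exact laplacian_smul c (contDiffAt_infty.1 (contDiffAt_radialExtension hf hx) 2)

/-- The round sphere measure on `S^n`. -/
def sphereMeasure (n : ℕ) : Measure (Sph n) :=
  (volume : Measure (EuclideanSpace ℝ (Fin (n + 1)))).toSphere

/-- The eigenspace `E(n, l)` of the Laplacian of the round sphere `S^n`: the smooth functions `f`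
with `-Δ f = l (l + n - 1) f`. -/
def eigenspace (n l : ℕ) : Submodule ℝ (Sph n → ℝ) where
  carrier := {f | ContMDiff (𝓡 n) 𝓘(ℝ, ℝ) ∞ f ∧
    ∀ x, -sphereLaplacian f x = (l : ℝ) * ((l : ℝ) + n - 1) * f x}
  zero_mem' := by
    have h0 : ContMDiff (𝓡 n) 𝓘(ℝ, ℝ) ∞ (0 : Sph n → ℝ) := contMDiff_const
    refine ⟨h0, fun x => ?_⟩
    have := sphereLaplacian_smul 0 h0 x
    simp only [zero_smul, zero_mul] at this
    simp [this]
  add_mem' := by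
    rintro f g ⟨hf, hf'⟩ ⟨hg, hg'⟩
    refine ⟨hf.add hg, fun x => ?_⟩
    rw [sphereLaplacian_add hf hg, Pi.add_apply, mul_add, ← hf' x, ← hg' x]
    ring
  smul_mem' := by
    rintro c f ⟨hf, hf'⟩
    have hc : ContMDiff (𝓡 n) 𝓘(ℝ, ℝ) ∞ (fun _ : Sph n => c) := contMDiff_const
    refine ⟨hc.smul hf, fun x => ?_⟩
    rw [sphereLaplacian_smul c hf, Pi.smul_apply, smul_eq_mul, mul_left_comm, ← hf' x]
    ring

/-- The dimension `D(n, l)` of the eigenspace `E(n, l)`. -/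
def eigenDim (n l : ℕ) : ℕ := Module.finrank ℝ (eigenspace n l)

/-- `f_1, …, f_D` is an `L²`-orthonormal basis of the eigenspace `E(n, l)`. -/
structure IsOrthonormalEigenbasis (n l : ℕ) (f : Fin (eigenDim n l) → Sph n → ℝ) : Prop where
  span_eq : Submodule.span ℝ (Set.range f) = eigenspace n l
  orthonormal : ∀ i j, ∫ x, f i x * f j x ∂(sphereMeasure n) = if i = j then 1 else 0

/-- The coordinates of the higher Veronese map `φ_{n,l} = (|S^n| / D)^{1/2} (f_1, …, f_D)`. -/
def veronese {n l : ℕ} (f : Fin (eigenDim n l) → Sph n → ℝ) (x : Sph n)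
    (i : Fin (eigenDim n l)) : ℝ :=
  √((sphereMeasure n).real Set.univ / eigenDim n l) * f i x

/-! ### Products of spheres and the map `F` -/

section Product

variable {M : ℕ}

/-- The product `X = ∏_m S^{n_m}`. -/
abbrev ProdSph (n : Fin M → ℕ) : Type := ∀ m, Sph (n m)

/-- The model with corners of the smooth manifold `∏_m S^{n_m}`. -/
abbrev prodModel (n : Fin M → ℕ) :
    ModelWithCorners ℝ (∀ m, EuclideanSpace ℝ (Fin (n m)))
      (ModelPi fun m => EuclideanSpace ℝ (Fin (n m))) :=
  ModelWithCorners.pi fun m => 𝓡 (n m)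

/-- The tensor product map `φ_l = ⊗_m φ_{n_m, l_m}` into `ℝ^L`, `L = ∏_m D(n_m, l_m)`: its
coordinates are the products of one coordinate of each factor. -/
def tensorVeronese {n : Fin M → ℕ} (f : ∀ m l, Fin (eigenDim (n m) l) → Sph (n m) → ℝ)
    (l : Fin M → ℕ) (x : ProdSph n) (i : ∀ m, Fin (eigenDim (n m) (l m))) : ℝ :=
  ∏ m, veronese (f m (l m)) (x m) (i m)

/-- The Euclidean space `ℝ^N = ⨁_{l ∈ supp α} ℝ^{L(n, l)}`. -/
abbrev Target (n : Fin M → ℕ) (α : (Fin M → ℕ) →₀ ℝ) : Type :=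
  EuclideanSpace ℝ (Σ l : α.support, ∀ m, Fin (eigenDim (n m) (l.1 m)))

/-- The map `F = ⨁_{l ∈ supp α} α(l)^{1/2} φ_l`. -/
def sumMap {n : Fin M → ℕ} (f : ∀ m l, Fin (eigenDim (n m) l) → Sph (n m) → ℝ)
    (α : (Fin M → ℕ) →₀ ℝ) (x : ProdSph n) : Target n α :=
  WithLp.toLp 2 fun k => √(α k.1.1) * tensorVeronese f k.1.1 x k.2

/-- `ρ(n, l) = l (l + n - 1) / n`. -/
def rho (n l : ℕ) : ℝ := (l : ℝ) * ((l : ℝ) + n - 1) / n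

/-- `λ(n, l) = (3 n / (n + 2)) ρ² - (2 (n - 1) / (n + 2)) ρ` with `ρ = ρ(n, l)`. -/
def lam (n l : ℕ) : ℝ :=
  3 * (n : ℝ) / (n + 2) * rho n l ^ 2 - 2 * ((n : ℝ) - 1) / (n + 2) * rho n l

/-- The expectation `𝔼[g] = ∑_l α(l) g(l)` for the measure `∑_l α(l) δ_l`. -/
def expect (α : (Fin M → ℕ) →₀ ℝ) (g : (Fin M → ℕ) → ℝ) : ℝ := ∑ l ∈ α.support, α l * g l

/-- The vector `G_m = 𝔼[ρ_m]`. -/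
def vecG (n : Fin M → ℕ) (α : (Fin M → ℕ) →₀ ℝ) (m : Fin M) : ℝ :=
  expect α fun l => rho (n m) (l m)

/-- The matrix `A` with `A_mm = 𝔼[λ_m]` and `A_ab = 3 𝔼[ρ_a ρ_b]` for `a ≠ b`. -/
def matA (n : Fin M → ℕ) (α : (Fin M → ℕ) →₀ ℝ) : Matrix (Fin M) (Fin M) ℝ :=
  Matrix.of fun a b =>
    if a = b then expect α fun l => lam (n a) (l a)
    else 3 * expect α fun l => rho (n a) (l a) * rho (n b) (l b)

/-- The matrix `B(s) = s G Gᵀ - A`. -/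
def matB (n : Fin M → ℕ) (α : (Fin M → ℕ) →₀ ℝ) (s : ℝ) : Matrix (Fin M) (Fin M) ℝ :=
  s • Matrix.vecMulVec (vecG n α) (vecG n α) - matA n α

/-- A symmetric matrix `B` is copositive if `Uᵀ B U ≥ 0` for all `U` with nonnegative entries. -/
def IsCopositive (B : Matrix (Fin M) (Fin M) ℝ) : Prop :=
  B.IsSymm ∧ ∀ U : Fin M → ℝ, (∀ m, 0 ≤ U m) → 0 ≤ dotProduct U (B.mulVec U)

end Product

end VeroneseProduct

end

/-! Everything is read off the kernels ⟨φ(x), φ(y)⟩ of the Veronese maps. Composing an orthonormal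
eigenbasis with a linear isometry gives another orthonormal basis of the same eigenspace, and the
kernel does not depend on the basis; so it is a function k(t) of the spherical distance t alone
(`kernel_eq_of_inner_eq`). This k is even, k(0) = 1, and the eigenvalue equation becomes sin² t k''
+ (n - 1) sin t cos t k' + Λ sin² t k = 0 with Λ = l(l + n - 1). Smoothness at the singular point t
= 0 forces k = 1 - ρ t²/2 + λ t⁴/24 + O(t⁵) (`exists_profile`), which is the origin of ρ and λ.

Let γ be a product of great circles with velocities u_m, and put U_m = |u_m|². Then ⟨F(γ(s)),
F(γ(t))⟩ = 𝔼 ∏ k_m(|u_m|(t - s)) is a function κ(t - s). Differentiating in s and t gives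
|(F∘γ)'(0)|² = -κ''(0) = G·U and |(F∘γ)''(0)|² = κ''''(0) = UᵀAU (`norm_sq_iteratedDeriv_geodesic`);
the mixed terms of the product give the off-diagonal entries 3 𝔼[ρ_a ρ_b].

The preferred charts are stereographic. Their lines through the centre agree with great circles to
second order, so the same formulas hold for the derivatives of F in the chart. Reflecting through
the centre preserves all inner products of values of F, so second derivatives there are orthogonal
to first ones: the second derivative already is 𝐀(u, u).

The pullback metric ∑ G_m |u_m|² is therefore positive definite, and 𝔠(F)² is the supremum of UᵀAU
over U ≥ 0 with G·U = 1. By homogeneity this is the least s ≥ 0 with UᵀAU ≤ s (G·U)² for all U ≥ 0,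
that is, with B(s) copositive. -/

noncomputable section

namespace VeroneseProduct

/-! ### Derivatives along curves -/

section Curves

variable {E : Type*} [NormedAddCommGroup E] [NormedSpace ℝ E]
  {V : Type*} [NormedAddCommGroup V] [NormedSpace ℝ V]

/-- First derivative of a function along a curve. -/
lemma hasDerivAt_comp_curve {g : E → V} {c : ℝ → E} {c' : E} {t : ℝ}
    (hg : ContDiffAt ℝ ∞ g (c t)) (hc : HasDerivAt c c' t) :
    HasDerivAt (fun s => g (c s)) (fderiv ℝ g (c t) c') t :=
  ((hg.differentiableAt (by simp)).hasFDerivAt).comp_hasDerivAt t hc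

/-- Second derivative of a function along a curve. -/
lemma iteratedDeriv_two_comp_curve {g : E → V} {c c' : ℝ → E} {c'' : E} {t : ℝ}
    (hg : ContDiffAt ℝ ∞ g (c t)) (hc : ∀ s, HasDerivAt c (c' s) s)
    (hc' : HasDerivAt c' c'' t) :
    iteratedDeriv 2 (fun s => g (c s)) t =
      iteratedFDeriv ℝ 2 g (c t) ![c' t, c' t] + fderiv ℝ g (c t) c'' := by
  have hev : ∀ᶠ s in nhds t, ContDiffAt ℝ 1 g (c s) :=
    (hc t).continuousAt.eventually
      ((contDiffAt_infty.1 hg 1).eventually (by simp))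
  have h1 : deriv (fun s => g (c s)) =ᶠ[nhds t] fun s => fderiv ℝ g (c s) (c' s) := by
    filter_upwards [hev] with s hs
    exact (((hs.differentiableAt (by simp)).hasFDerivAt).comp_hasDerivAt s (hc s)).deriv
  have h2 : HasFDerivAt (fderiv ℝ g) (fderiv ℝ (fderiv ℝ g) (c t)) (c t) :=
    (((contDiffAt_infty.1 hg 2).fderiv_right (m := 1) (by norm_num)).differentiableAt
      (by simp)).hasFDerivAt
  have h3 := (h2.comp_hasDerivAt t (hc t)).clm_apply hc'
  rw [iteratedDeriv_succ, iteratedDeriv_one, h1.deriv_eq, iteratedFDeriv_two_apply]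
  simpa using h3.deriv

end Curves

/-! ### Isometry invariance of the eigenspaces and of the sphere measure -/

section Isometries

variable {n : ℕ}

local notation "𝔼" n => EuclideanSpace ℝ (Fin (n + 1))

/-- The action of a linear isometry on the unit sphere. -/
def sphereMap (L : (𝔼 n) ≃ₗᵢ[ℝ] (𝔼 n)) (x : Sph n) : Sph n :=
  ⟨L x, by simp⟩

lemma contMDiff_sphereMap (L : (𝔼 n) ≃ₗᵢ[ℝ] (𝔼 n)) :
    ContMDiff (𝓡 n) (𝓡 n) ∞ (sphereMap L) := by
  have := Fact.mk (finrank_euclideanSpace_fin (𝕜 := ℝ) (n := n + 1))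
  have h : ContMDiff (𝓡 n) 𝓘(ℝ, 𝔼 n) ∞ (fun x : Sph n => L x) :=
    L.contDiff.contMDiff.comp contMDiff_coe_sphere
  exact h.codRestrict_sphere (n := n) (fun x => by simp)

lemma radialExtension_comp_sphereMap (L : (𝔼 n) ≃ₗᵢ[ℝ] (𝔼 n)) (f : Sph n → ℝ) :
    radialExtension (f ∘ sphereMap L) = radialExtension f ∘ L := by
  ext y
  by_cases hy : y = 0
  · simp [radialExtension, hy]
  · have : L y ≠ 0 := by simpa using hy
    simp only [radialExtension, hy, this, dite_false, Function.comp_apply]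
    congr 1
    ext1
    simp [sphereMap]

lemma radialExtension_apply (f : Sph n → ℝ) (x : Sph n) : radialExtension f x = f x := by
  have hx : (x : 𝔼 n) ≠ 0 := ne_zero_of_mem_unit_sphere x
  simp only [radialExtension, hx, dite_false]
  congr 1
  ext1
  simp

/-- The Laplacian is the trace of the second derivative in any orthonormal basis; the right side is
computed in the image under `L` of the basis used on the left. -/
lemma laplacian_comp_isometry {E : Type*} [NormedAddCommGroup E] [InnerProductSpace ℝ E]
    [FiniteDimensional ℝ E] (L : E ≃ₗᵢ[ℝ] E) (g : E → ℝ) (x : E) :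
    Laplacian.laplacian (g ∘ L) x = Laplacian.laplacian g (L x) := by
  rw [laplacian_eq_iteratedFDeriv_orthonormalBasis (g ∘ L) (stdOrthonormalBasis ℝ E),
    laplacian_eq_iteratedFDeriv_orthonormalBasis g ((stdOrthonormalBasis ℝ E).map L)]
  refine Finset.sum_congr rfl fun i _ => ?_
  have := L.toContinuousLinearEquiv.iteratedFDerivWithin_comp_right g
    (s := Set.univ) uniqueDiffOn_univ (x := x) (Set.mem_univ _) 2
  have h2 : iteratedFDeriv ℝ 2 (g ∘ L) x = (iteratedFDeriv ℝ 2 g (L x)).compContinuousLinearMap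
    fun _ => (L.toContinuousLinearEquiv : E →L[ℝ] E) := by
    rw [Set.preimage_univ, iteratedFDerivWithin_univ, iteratedFDerivWithin_univ] at this
    exact this
  rw [h2, ContinuousMultilinearMap.compContinuousLinearMap_apply]
  congr 1
  ext j
  fin_cases j <;> simp

lemma sphereLaplacian_comp_sphereMap (L : (𝔼 n) ≃ₗᵢ[ℝ] (𝔼 n)) (f : Sph n → ℝ) (x : Sph n) :
    sphereLaplacian (f ∘ sphereMap L) x = sphereLaplacian f (sphereMap L x) := by
  rw [sphereLaplacian, radialExtension_comp_sphereMap, laplacian_comp_isometry]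
  rfl

lemma comp_sphereMap_mem_eigenspace (L : (𝔼 n) ≃ₗᵢ[ℝ] (𝔼 n)) {l : ℕ} {f : Sph n → ℝ}
    (hf : f ∈ eigenspace n l) : f ∘ sphereMap L ∈ eigenspace n l := by
  refine ⟨hf.1.comp (contMDiff_sphereMap L), fun x => ?_⟩
  rw [sphereLaplacian_comp_sphereMap]
  exact hf.2 _

lemma continuous_sphereMap (L : (𝔼 n) ≃ₗᵢ[ℝ] (𝔼 n)) : Continuous (sphereMap L) :=
  (contMDiff_sphereMap L).continuous

open scoped Pointwise in
/-- The sphere measure is invariant under linear isometries. -/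
lemma measurePreserving_sphereMap (L : (𝔼 n) ≃ₗᵢ[ℝ] (𝔼 n)) :
    MeasurePreserving (sphereMap L) (sphereMeasure n) (sphereMeasure n) := by
  refine ⟨(continuous_sphereMap L).measurable, ?_⟩
  ext s hs
  rw [Measure.map_apply (continuous_sphereMap L).measurable hs, sphereMeasure,
    Measure.toSphere_apply' _ hs,
    Measure.toSphere_apply' _ ((continuous_sphereMap L).measurable hs)]
  congr 1
  rw [← (L.measurePreserving).measure_preimage_equiv (f := L.toMeasurableEquiv)
    (Set.Ioo (0 : ℝ) 1 • (Subtype.val '' s))]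
  congr 1
  ext y
  simp only [Set.mem_smul, Set.mem_image, Set.mem_preimage]
  constructor
  · rintro ⟨r, hr, _, ⟨x, hx, rfl⟩, rfl⟩
    exact ⟨r, hr, _, ⟨_, hx, rfl⟩, by simp [sphereMap]⟩
  · rintro ⟨r, hr, _, ⟨x, hx, rfl⟩, h⟩
    refine ⟨r, hr, _, ⟨sphereMap L.symm x, ?_, rfl⟩, ?_⟩
    · have : sphereMap L (sphereMap L.symm x) = x := by ext1; simp [sphereMap]
      rwa [this]
    · apply L.injective
      simpa [sphereMap] using h

/-- The isometry group acts transitively on pairs of points of the sphere with a given inner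
product. -/
lemma exists_isometry_pair {E : Type*} [NormedAddCommGroup E] [InnerProductSpace ℝ E]
    {x y x' y' : E} (hx : ‖x‖ = ‖x'‖) (hy : ‖y‖ = ‖y'‖)
    (h : inner ℝ x y = inner ℝ x' y') : ∃ L : E ≃ₗᵢ[ℝ] E, L x = x' ∧ L y = y' := by
  let R : E ≃ₗᵢ[ℝ] E := Submodule.reflection (ℝ ∙ (x - x'))ᗮ
  have hR : R x = x' := Submodule.reflection_sub hx
  let T : E ≃ₗᵢ[ℝ] E := Submodule.reflection (ℝ ∙ (R y - y'))ᗮ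
  have hT : T (R y) = y' := Submodule.reflection_sub (by simp [hy])
  refine ⟨R.trans T, ?_, by simpa using hT⟩
  -- The second reflection does not spoil the first: equality of the inner products makes `x'`
  -- orthogonal to `R y - y'`.
  have hT' : T x' = x' := by
    apply Submodule.reflection_mem_subspace_eq_self
    rw [Submodule.mem_orthogonal_singleton_iff_inner_left, inner_sub_right, ← h]
    nth_rewrite 1 [← hR]
    rw [R.inner_map_map, sub_self]
  simp [hR, hT']

end Isometries

/-! ### The reproducing kernel of a Veronese map -/

section Kernel

/-- For two bases of the same space of functions which are orthonormal for a positive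
semidefinite bilinear form, the reproducing kernels agree. -/
lemma sum_mul_eq_of_orthonormal {X ι : Type*} [Fintype ι] [DecidableEq ι]
    [TopologicalSpace X] [CompactSpace X] [MeasurableSpace X] [BorelSpace X]
    (μ : Measure X) [IsFiniteMeasure μ] {f g : ι → X → ℝ} (hfc : ∀ i, Continuous (f i))
    (hfo : ∀ i j, ∫ x, f i x * f j x ∂μ = if i = j then 1 else 0)
    (hgo : ∀ i j, ∫ x, g i x * g j x ∂μ = if i = j then 1 else 0)
    (hg : ∀ i, g i ∈ Submodule.span ℝ (Set.range f)) (x y : X) :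
    ∑ i, g i x * g i y = ∑ i, f i x * f i y := by
  choose A hA using fun i => (Submodule.mem_span_range_iff_exists_fun ℝ).1 (hg i)
  have hgA : ∀ j x, g j x = ∑ i, A j i * f i x := fun j x => by
    rw [← hA j]; simp
  let P : Matrix ι ι ℝ := Matrix.of A
  have hint : ∀ i j, Integrable (fun x => f i x * f j x) μ := fun i j =>
    ((hfc i).mul (hfc j)).integrable_of_hasCompactSupport (HasCompactSupport.of_compactSpace _)
  have hP : P * P.transpose = 1 := by
    ext j k
    rw [Matrix.one_apply, ← hgo j k, Matrix.mul_apply]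
    have : ∀ x, g j x * g k x = ∑ a, ∑ b, (A j a * A k b) * (f a x * f b x) := fun x => by
      rw [hgA, hgA, Finset.sum_mul_sum]
      refine Finset.sum_congr rfl fun a _ => Finset.sum_congr rfl fun b _ => by ring
    simp_rw [this]
    rw [integral_finsetSum _ fun a _ => integrable_finsetSum _ fun b _ =>
      (hint a b).const_mul _]
    refine Finset.sum_congr rfl fun a _ => ?_
    rw [integral_finsetSum _ fun b _ => (hint a b).const_mul _]
    simp [integral_const_mul, hfo, P]
  -- Orthonormality gives orthogonal rows; the kernel identity needs orthogonal columns, which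
  -- follow because the matrix is square.
  have hP' : P.transpose * P = 1 := mul_eq_one_comm.1 hP
  have hP2 : ∀ a b, ∑ i, A i a * A i b = if a = b then 1 else 0 := fun a b => by
    have := congrFun (congrFun hP' a) b
    rwa [Matrix.mul_apply, Matrix.one_apply] at this
  calc ∑ i, g i x * g i y = ∑ i, ∑ a, ∑ b, (A i a * A i b) * (f a x * f b y) := by
        refine Finset.sum_congr rfl fun i _ => ?_
        rw [hgA, hgA, Finset.sum_mul_sum]
        refine Finset.sum_congr rfl fun a _ => Finset.sum_congr rfl fun b _ => by ring
    _ = ∑ a, ∑ b, (∑ i, A i a * A i b) * (f a x * f b y) := by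
        rw [Finset.sum_comm]
        refine Finset.sum_congr rfl fun a _ => ?_
        rw [Finset.sum_comm]
        refine Finset.sum_congr rfl fun b _ => ?_
        rw [Finset.sum_mul]
    _ = ∑ i, f i x * f i y := by
        simp [hP2]

variable {n l : ℕ}

/-- The kernel `⟨φ(x), φ(y)⟩` of the Veronese map `φ`. -/
def kernel (f : Fin (eigenDim n l) → Sph n → ℝ) (x y : Sph n) : ℝ :=
  ∑ i, veronese f x i * veronese f y i

lemma IsOrthonormalEigenbasis.mem {f : Fin (eigenDim n l) → Sph n → ℝ}
    (hf : IsOrthonormalEigenbasis n l f) (i : Fin (eigenDim n l)) : f i ∈ eigenspace n l := by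
  rw [← hf.span_eq]
  exact Submodule.subset_span ⟨i, rfl⟩

lemma IsOrthonormalEigenbasis.continuous {f : Fin (eigenDim n l) → Sph n → ℝ}
    (hf : IsOrthonormalEigenbasis n l f) (i : Fin (eigenDim n l)) : Continuous (f i) :=
  (hf.mem i).1.continuous

instance : IsFiniteMeasure (sphereMeasure n) := by
  unfold sphereMeasure; infer_instance

lemma kernel_eq (f : Fin (eigenDim n l) → Sph n → ℝ) (x y : Sph n) :
    kernel f x y = (sphereMeasure n).real Set.univ / eigenDim n l * ∑ i, f i x * f i y := by
  have h : 0 ≤ (sphereMeasure n).real Set.univ / eigenDim n l := by positivity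
  simp only [kernel, veronese, Finset.mul_sum]
  refine Finset.sum_congr rfl fun i _ => ?_
  rw [mul_mul_mul_comm, Real.mul_self_sqrt h]

/-- The functions `f i ∘ sphereMap L` form another orthonormal family in the same eigenspace, so
they have the same kernel. -/
lemma kernel_sphereMap {f : Fin (eigenDim n l) → Sph n → ℝ} (hf : IsOrthonormalEigenbasis n l f)
    (L : EuclideanSpace ℝ (Fin (n + 1)) ≃ₗᵢ[ℝ] EuclideanSpace ℝ (Fin (n + 1))) (x y : Sph n) :
    kernel f (sphereMap L x) (sphereMap L y) = kernel f x y := by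
  rw [kernel_eq, kernel_eq]
  congr 1
  refine sum_mul_eq_of_orthonormal (sphereMeasure n) (g := fun i => f i ∘ sphereMap L)
    hf.continuous hf.orthonormal (fun i j => ?_) (fun i => ?_) x y
  · have h := integral_map (μ := sphereMeasure n) (continuous_sphereMap L).aemeasurable
      (f := fun x => f i x * f j x)
      ((hf.continuous i).mul (hf.continuous j)).aestronglyMeasurable
    rw [(measurePreserving_sphereMap L).map_eq, hf.orthonormal i j] at h
    exact h.symm
  · rw [hf.span_eq]
    exact comp_sphereMap_mem_eigenspace L (hf.mem i)

/-- The kernel depends only on the spherical distance of its arguments. -/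
lemma kernel_eq_of_inner_eq {f : Fin (eigenDim n l) → Sph n → ℝ}
    (hf : IsOrthonormalEigenbasis n l f) {x y x' y' : Sph n}
    (h : inner ℝ (x : EuclideanSpace ℝ (Fin (n + 1))) (y : EuclideanSpace ℝ (Fin (n + 1))) =
      inner ℝ (x' : EuclideanSpace ℝ (Fin (n + 1))) (y' : EuclideanSpace ℝ (Fin (n + 1)))) :
    kernel f x y = kernel f x' y' := by
  obtain ⟨L, hx, hy⟩ := exists_isometry_pair (by simp) (by simp) h
  rw [← kernel_sphereMap hf L]
  congr 1
  · ext1; exact hx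
  · ext1; exact hy

/-- The diagonal is constant because isometries act transitively on points; integrating ∑ f_i² to
`D` fixes the constant, and the normalisation of φ turns it into 1. -/
lemma kernel_self {f : Fin (eigenDim n l) → Sph n → ℝ}
    (hf : IsOrthonormalEigenbasis n l f) (hD : eigenDim n l ≠ 0) (x : Sph n) :
    kernel f x x = 1 := by
  have hconst : ∀ y, ∑ i, f i y * f i y = ∑ i, f i x * f i x := fun y => by
    have h := kernel_eq_of_inner_eq hf (x := y) (y := y) (x' := x) (y' := x) (by simp)
    have hpos : 0 < (sphereMeasure n).real Set.univ := by
      rw [Measure.real, ENNReal.toReal_pos_iff]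
      exact ⟨pos_iff_ne_zero.2 (Measure.measure_univ_ne_zero.2 (Measure.toSphere_ne_zero _)),
        measure_lt_top _ _⟩
    rw [kernel_eq, kernel_eq] at h
    have hD' : (eigenDim n l : ℝ) ≠ 0 := by exact_mod_cast hD
    exact mul_left_cancel₀ (by positivity) h
  have hint : ∫ y, ∑ i, f i y * f i y ∂(sphereMeasure n) = eigenDim n l := by
    have hi : ∀ i, Integrable (fun y => f i y * f i y) (sphereMeasure n) := fun i =>
      ((hf.continuous i).mul (hf.continuous i)).integrable_of_hasCompactSupport
        (HasCompactSupport.of_compactSpace _)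
    rw [integral_finsetSum _ fun i _ => hi i]
    simp [hf.orthonormal]
  simp_rw [hconst] at hint
  rw [integral_const, smul_eq_mul] at hint
  have hD' : (eigenDim n l : ℝ) ≠ 0 := by exact_mod_cast hD
  rw [kernel_eq, div_mul_eq_mul_div, hint, div_self hD']

end Kernel

/-! ### The eigenspaces are nonzero -/

section Nontrivial

/-- The harmonic polynomial `Re (x_0 + i x_1)^l`. -/
def rePow (n l : ℕ) (y : EuclideanSpace ℝ (Fin (n + 2))) : ℝ := ((⟨y 0, y 1⟩ : ℂ) ^ l).re

lemma radialExtension_rePow (n l : ℕ) {y : EuclideanSpace ℝ (Fin (n + 2))} (hy : y ≠ 0) :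
    radialExtension (fun x : Sph (n + 1) => rePow n l x) y = (‖y‖ ^ l)⁻¹ * rePow n l y := by
  simp only [radialExtension, hy, dite_false, rePow]
  have : (⟨(‖y‖⁻¹ • y) 0, (‖y‖⁻¹ • y) 1⟩ : ℂ) = ((‖y‖⁻¹ : ℝ) : ℂ) * ⟨y 0, y 1⟩ := by
    apply Complex.ext <;> simp
  rw [this, mul_pow, ← Complex.ofReal_pow, Complex.re_ofReal_mul, inv_pow]

lemma contDiff_rePow (n l : ℕ) : ContDiff ℝ ∞ (rePow n l) := by
  have h : rePow n l = fun y => Complex.reCLM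
      (((Complex.ofRealCLM (EuclideanSpace.proj (𝕜 := ℝ) (0 : Fin (n + 2)) y)) +
        (Complex.ofRealCLM (EuclideanSpace.proj (𝕜 := ℝ) (1 : Fin (n + 2)) y)) * Complex.I) ^ l) := by
    ext y
    simp [rePow, ← Complex.mk_eq_add_mul_I]
  rw [h]
  fun_prop

lemma iteratedDeriv_two_eq {f f' : ℝ → ℝ} {f'' t : ℝ}
    (h1 : ∀ᶠ s in nhds t, HasDerivAt f (f' s) s) (h2 : HasDerivAt f' f'' t) :
    iteratedDeriv 2 f t = f'' := by
  rw [iteratedDeriv_succ, iteratedDeriv_one,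
    Filter.EventuallyEq.deriv_eq (h1.mono fun s hs => hs.deriv), h2.deriv]

/-- The radial extension is |y|^(-l) Re z^l with z = y_0 + i y_1. Its Laplacian combines the radial
factor, Euler's identity for the cross term, and harmonicity of Re z^l. This exhibits an
eigenfunction with eigenvalue l(l + n) on the (n + 1)-sphere. -/
lemma sphereLaplacian_rePow (n l : ℕ) (x : Sph (n + 1)) :
    sphereLaplacian (fun x : Sph (n + 1) => rePow n l x) x =
      -((l : ℝ) * (l + n) * rePow n l x) := by
  have := Fact.mk (finrank_euclideanSpace_fin (𝕜 := ℝ) (n := n + 1 + 1))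
  have hx0 : (x : EuclideanSpace ℝ (Fin (n + 2))) ≠ 0 := ne_zero_of_mem_unit_sphere x
  have hsm : ContMDiff (𝓡 (n + 1)) 𝓘(ℝ, ℝ) ∞ (fun x : Sph (n + 1) => rePow n l x) :=
    (contDiff_rePow n l).contMDiff.comp contMDiff_coe_sphere
  -- `δ i` is the derivative of z in the i-th coordinate direction.
  obtain ⟨δ, hδ0, hδ1, hδ2⟩ : ∃ δ : Fin (n + 2) → ℂ, δ 0 = 1 ∧ δ 1 = Complex.I ∧
      ∀ i : Fin n, δ i.succ.succ = 0 :=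
    ⟨Fin.cons (1 : ℂ) (Fin.cons Complex.I fun _ => 0), rfl, rfl, fun _ => rfl⟩
  have hδ1' : δ (Fin.succ 0) = Complex.I := hδ1
  let z : ℂ := ⟨(x : EuclideanSpace ℝ (Fin (n + 2))) 0, (x : EuclideanSpace ℝ (Fin (n + 2))) 1⟩
  let X : Fin (n + 2) → ℝ := fun i => (x : EuclideanSpace ℝ (Fin (n + 2))) i
  have hX : ∑ i, X i ^ 2 = 1 := by
    have := EuclideanSpace.real_norm_sq_eq (x : EuclideanSpace ℝ (Fin (n + 2)))
    rw [← this]; simp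
  -- Product rule for (|y|²)^(-l/2) · Re z^l along the line x + t e_i: the terms P''Q, 2P'Q' and
  -- PQ'' at t = 0.
  have key : ∀ i : Fin (n + 2), iteratedFDeriv ℝ 2
      (radialExtension fun x : Sph (n + 1) => rePow n l x) x
      ![EuclideanSpace.basisFun _ ℝ i, EuclideanSpace.basisFun _ ℝ i] =
      (l * (l + 2) * X i ^ 2 - l) * (z ^ l).re
        + 2 * (-(l * X i)) * (l * z ^ (l - 1) * δ i).re
        + (l * ((l - 1 : ℕ) * z ^ (l - 1 - 1) * δ i) * δ i).re := by
    intro i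
    let c : ℝ → EuclideanSpace ℝ (Fin (n + 2)) := fun t =>
      (x : EuclideanSpace ℝ (Fin (n + 2))) + t • EuclideanSpace.basisFun _ ℝ i
    have hc : ∀ s, HasDerivAt c (EuclideanSpace.basisFun _ ℝ i) s := fun s => by
      have := ((hasDerivAt_id s).smul_const (EuclideanSpace.basisFun _ ℝ i)).const_add
        (x : EuclideanSpace ℝ (Fin (n + 2)))
      rwa [one_smul] at this
    have hc0 : c 0 = x := by simp [c]
    have h2 := iteratedDeriv_two_comp_curve (g := radialExtension
      fun x : Sph (n + 1) => rePow n l x) (c := c) (t := 0)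
      (by rw [hc0]; exact contDiffAt_radialExtension hsm hx0) hc (hasDerivAt_const _ _)
    rw [hc0, map_zero, add_zero] at h2
    rw [← h2]
    have hN : ∀ t, ‖c t‖ ^ 2 = 1 + 2 * t * X i + t ^ 2 := fun t => by
      simp only [c, norm_add_sq_real, norm_smul]
      simp [X, inner_smul_right, EuclideanSpace.inner_single_right]
      ring
    have hz : ∀ t, (⟨c t 0, c t 1⟩ : ℂ) = z + t * δ i := fun t => by
      simp only [c]
      have h0 : ∀ k : Fin n, ¬ (1 : Fin (n + 2)) = k.succ.succ := fun k hk => by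
        simp [Fin.ext_iff] at hk
      refine Fin.cases ?_ (fun j => Fin.cases ?_ (fun k => ?_) j) i
      · apply Complex.ext <;> simp [z, hδ0]
      · apply Complex.ext <;> simp [z, hδ1]
      · apply Complex.ext <;> simp [z, hδ2, h0]
    have hne : ∀ᶠ t in nhds (0 : ℝ), c t ≠ 0 := (hc 0).continuousAt.eventually_ne (by rwa [hc0])
    have hR : (fun t => radialExtension (fun x : Sph (n + 1) => rePow n l x) (c t)) =ᶠ[nhds 0]
        fun t => (1 + 2 * t * X i + t ^ 2) ^ (-(l : ℝ) / 2) * ((z + t * δ i) ^ l).re := by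
      filter_upwards [hne] with t ht
      rw [radialExtension_rePow _ _ ht, rePow, hz, ← hN, ← Real.rpow_natCast ‖c t‖ 2,
        ← Real.rpow_mul (norm_nonneg _), ← Real.rpow_natCast, ← Real.rpow_neg (norm_nonneg _)]
      congr 2
      push_cast; ring
    rw [hR.iteratedDeriv_eq]
    have hpos : ∀ᶠ t in nhds (0 : ℝ), (1 + 2 * t * X i + t ^ 2) ≠ 0 := by
      filter_upwards [hne] with t ht
      rw [← hN]; positivity
    let a : ℝ := -(l : ℝ) / 2
    have hNd : ∀ t, HasDerivAt (fun t : ℝ => 1 + 2 * t * X i + t ^ 2) (2 * X i + 2 * t) t :=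
      fun t => by
      convert! (((hasDerivAt_id t).const_mul 2).mul_const (X i)).const_add 1 |>.add
        ((hasDerivAt_id t).pow 2) using 1
      simp
    have hP : ∀ᶠ t in nhds (0 : ℝ), HasDerivAt (fun t : ℝ => (1 + 2 * t * X i + t ^ 2) ^ a)
        ((2 * X i + 2 * t) * a * (1 + 2 * t * X i + t ^ 2) ^ (a - 1)) t := by
      filter_upwards [hpos] with t ht
      exact (hNd t).rpow_const (Or.inl ht)
    have hP' : HasDerivAt (fun t : ℝ => (2 * X i + 2 * t) * a *
        (1 + 2 * t * X i + t ^ 2) ^ (a - 1)) (l * (l + 2) * X i ^ 2 - l) 0 := by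
      have h1 := (((hasDerivAt_id (0 : ℝ)).const_mul 2).const_add (2 * X i)).mul_const a
      have h3 := h1.mul ((hNd 0).rpow_const (p := a - 1) (Or.inl (by simp)))
      convert! h3 using 1
      simp [a]; ring
    have hzd : ∀ t : ℝ, HasDerivAt (fun t : ℝ => z + t * δ i) (δ i) t := fun t => by
      simpa using ((Complex.ofRealCLM.hasDerivAt (x := t)).mul_const (δ i)).const_add z
    have hpow : ∀ (k : ℕ) (t : ℝ), HasDerivAt (fun t : ℝ => (z + t * δ i) ^ k)
      (k * (z + t * δ i) ^ (k - 1) * δ i) t := fun k t => (hzd t).pow k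
    have hQ : ∀ t : ℝ, HasDerivAt (fun t : ℝ => ((z + t * δ i) ^ l).re)
        ((l * (z + t * δ i) ^ (l - 1) * δ i).re) t := fun t =>
      Complex.reCLM.hasFDerivAt.comp_hasDerivAt t (hpow l t)
    have hQ' : HasDerivAt (fun t : ℝ => (l * (z + t * δ i) ^ (l - 1) * δ i).re)
        ((l * ((l - 1 : ℕ) * z ^ (l - 1 - 1) * δ i) * δ i).re) 0 := by
      have := Complex.reCLM.hasFDerivAt.comp_hasDerivAt (0 : ℝ)
        (((hpow (l - 1) 0).const_mul (l : ℂ)).mul_const (δ i))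
      rw [Complex.ofReal_zero, zero_mul, add_zero] at this
      exact this
    refine iteratedDeriv_two_eq (hP.mono fun t ht => ht.mul (hQ t)) ?_
    convert! (hP'.mul (hQ 0)).add (hP.self_of_nhds.mul hQ') using 1
    simp [a]; ring
  rw [sphereLaplacian, laplacian_eq_iteratedFDeriv_orthonormalBasis _
    (EuclideanSpace.basisFun (Fin (n + 2)) ℝ)]
  simp only
  rw [Finset.sum_congr rfl fun i _ => key i]
  have hsum1 : ∑ i, (l * (l + 2) * X i ^ 2 - l) * (z ^ l).re =
      (l * (l + 2) - (n + 2) * l) * (z ^ l).re := by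
    rw [← Finset.sum_mul, Finset.sum_sub_distrib, ← Finset.mul_sum, hX]
    simp
  have hsum2 : ∑ i, 2 * (-(l * X i)) * (l * z ^ (l - 1) * δ i).re = -2 * l ^ 2 * (z ^ l).re := by
    rw [Fin.sum_univ_succ, Fin.sum_univ_succ]
    simp only [hδ2, hδ0, hδ1', mul_zero, Complex.zero_re, Finset.sum_const_zero]
    rcases l with _ | l
    · simp
    · have hz : z = X 0 + X 1 * Complex.I := by apply Complex.ext <;> simp [z, X]
      have : (z ^ (l + 1)).re = X 0 * (z ^ l).re - X 1 * (z ^ l).im := by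
        rw [pow_succ]; nth_rewrite 2 [hz]; simp; ring
      rw [this]
      simp; ring
  -- Harmonicity: the only contributions have δ² = 1 and δ² = i² = -1, and they cancel.
  have hsum3 : ∑ i, (l * ((l - 1 : ℕ) * z ^ (l - 1 - 1) * δ i) * δ i).re = 0 := by
    rw [Fin.sum_univ_succ, Fin.sum_univ_succ]
    simp [hδ0, hδ1, hδ2]
  rw [Finset.sum_add_distrib, Finset.sum_add_distrib, hsum1, hsum2, hsum3, rePow]
  ring

/-- `Module.finrank` is also 0 for an infinite-dimensional space, so the basis is needed: if the
dimension were 0, the empty family would span the eigenspace, which contains the nonzero function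
`rePow`. -/
lemma eigenDim_ne_zero {n l : ℕ} (hn : 1 ≤ n) {f : Fin (eigenDim n l) → Sph n → ℝ}
    (hf : IsOrthonormalEigenbasis n l f) : eigenDim n l ≠ 0 := by
  intro h0
  obtain ⟨n, rfl⟩ : ∃ k, n = k + 1 := ⟨n - 1, by omega⟩
  have := Fact.mk (finrank_euclideanSpace_fin (𝕜 := ℝ) (n := n + 1 + 1))
  have hmem : (fun x : Sph (n + 1) => rePow n l x) ∈ eigenspace (n + 1) l := by
    refine ⟨(contDiff_rePow n l).contMDiff.comp contMDiff_coe_sphere, fun x => ?_⟩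
    rw [sphereLaplacian_rePow]
    push_cast; ring
  have : IsEmpty (Fin (eigenDim (n + 1) l)) := by rw [h0]; infer_instance
  rw [← hf.span_eq, Set.range_eq_empty, Submodule.span_empty, Submodule.mem_bot] at hmem
  have := congrFun hmem ⟨EuclideanSpace.single 0 1, by simp⟩
  simp only [rePow, Pi.zero_apply] at this
  have h1 : (⟨1, 0⟩ : ℂ) = 1 := rfl
  simp [h1] at this

end Nontrivial

/-! ### Fourth-order jets of even functions -/

section Jets

/-- `g` is smooth with Taylor expansion `1 + b t² / 2 + c t⁴ / 24 + O(t⁵)` at `0`. -/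
structure HasEvenJet (g : ℝ → ℝ) (b c : ℝ) : Prop where
  contDiff : ContDiff ℝ ∞ g
  zero : g 0 = 1
  one : iteratedDeriv 1 g 0 = 0
  two : iteratedDeriv 2 g 0 = b
  three : iteratedDeriv 3 g 0 = 0
  four : iteratedDeriv 4 g 0 = c

lemma HasEvenJet.mul {g h : ℝ → ℝ} {b c b' c' : ℝ} (hg : HasEvenJet g b c)
    (hh : HasEvenJet h b' c') : HasEvenJet (g * h) (b + b') (c + c' + 6 * b * b') := by
  have key : ∀ k : ℕ, iteratedDeriv k (g * h) 0 = ∑ i ∈ .range (k + 1),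
      k.choose i * iteratedDeriv i g 0 * iteratedDeriv (k - i) h 0 := fun k =>
    iteratedDeriv_mul (contDiffAt_infty.1 hg.contDiff.contDiffAt k)
      (contDiffAt_infty.1 hh.contDiff.contDiffAt k)
  have h4 : Nat.choose 4 2 = 6 := rfl
  refine ⟨hg.contDiff.mul hh.contDiff, by simp [hg.zero, hh.zero], ?_, ?_, ?_, ?_⟩ <;>
  · rw [key]
    simp only [Finset.sum_range_succ, Finset.sum_range_zero, iteratedDeriv_zero, hg.zero, hh.zero,
      hg.one, hh.one, hg.two, hh.two, hg.three, hh.three, hg.four, hh.four, Nat.sub_self,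
      Nat.sub_zero, Nat.reduceSub, Nat.choose_self, Nat.choose_zero_right, h4]
    push_cast
    ring

lemma HasEvenJet.const_one : HasEvenJet (fun _ => 1) 0 0 :=
  ⟨contDiff_const, rfl, by simp [iteratedDeriv_const], by simp [iteratedDeriv_const],
    by simp [iteratedDeriv_const], by simp [iteratedDeriv_const]⟩

/-- By Leibniz each pair of factors contributes 6 b_i b_j to the fourth derivative; 3((∑ b)² - ∑ b²)
is the sum of these over unordered pairs. -/
lemma HasEvenJet.prod {ι : Type*} (s : Finset ι) {g : ι → ℝ → ℝ} {b c : ι → ℝ}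
    (hg : ∀ i, HasEvenJet (g i) (b i) (c i)) :
    HasEvenJet (fun t => ∏ i ∈ s, g i t) (∑ i ∈ s, b i)
      (∑ i ∈ s, c i + 3 * ((∑ i ∈ s, b i) ^ 2 - ∑ i ∈ s, b i ^ 2)) := by
  classical
  induction s using Finset.induction_on with
  | empty => simpa using HasEvenJet.const_one
  | insert a s ha ih =>
    have h := (hg a).mul ih
    convert! h using 1
    · ext t; simp [Finset.prod_insert ha]
    · rw [Finset.sum_insert ha]
    · rw [Finset.sum_insert ha, Finset.sum_insert ha, Finset.sum_insert ha]; ring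

lemma HasEvenJet.comp_mul {g : ℝ → ℝ} {b c : ℝ} (hg : HasEvenJet g b c) (r : ℝ) :
    HasEvenJet (fun t => g (r * t)) (b * r ^ 2) (c * r ^ 4) := by
  have key : ∀ k : ℕ, iteratedDeriv k (fun t => g (r * t)) 0 = r ^ k * iteratedDeriv k g 0 :=
    fun k => by
      have := congrFun (iteratedDeriv_comp_const_mul (n := k)
        (contDiff_infty.1 hg.contDiff k) r) 0
      simpa using this
  refine ⟨hg.contDiff.comp (contDiff_const.mul contDiff_id), by simp [hg.zero], ?_, ?_, ?_, ?_⟩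
  · rw [key, hg.one, mul_zero]
  · rw [key, hg.two, mul_comm]
  · rw [key, hg.three, mul_zero]
  · rw [key, hg.four, mul_comm]

/-- A convex combination of functions with even jets. -/
lemma HasEvenJet.sum {ι : Type*} (s : Finset ι) {w : ι → ℝ} (hw : ∑ i ∈ s, w i = 1)
    {g : ι → ℝ → ℝ} {b c : ι → ℝ} (hg : ∀ i, HasEvenJet (g i) (b i) (c i)) :
    HasEvenJet (fun t => ∑ i ∈ s, w i * g i t) (∑ i ∈ s, w i * b i) (∑ i ∈ s, w i * c i) := by
  have hs : ∀ i, ContDiff ℝ ∞ fun t => w i * g i t := fun i => contDiff_const.mul (hg i).contDiff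
  have key : ∀ k : ℕ, iteratedDeriv k (fun t => ∑ i ∈ s, w i * g i t) 0 =
      ∑ i ∈ s, w i * iteratedDeriv k (g i) 0 := fun k => by
    rw [iteratedDeriv_fun_sum fun i _ => contDiffAt_infty.1 (hs i).contDiffAt k]
    refine Finset.sum_congr rfl fun i _ => ?_
    rw [iteratedDeriv_const_mul _ (contDiffAt_infty.1 (hg i).contDiff.contDiffAt k)]
  refine ⟨ContDiff.sum fun i _ => hs i, by simp [(hg _).zero, hw], ?_, ?_, ?_, ?_⟩
  · simp [key, (hg _).one]
  · simp [key, (hg _).two]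
  · simp [key, (hg _).three]
  · simp [key, (hg _).four]

/-- An even smooth solution of the equation of zonal functions on the `n`-sphere. -/
lemma hasEvenJet_of_ode {k : ℝ → ℝ} (hk : ContDiff ℝ ∞ k) (heven : ∀ t, k (-t) = k t)
    (h0 : k 0 = 1) {ν Λ : ℝ} (hν : 0 < ν)
    (hode : ∀ t, Real.sin t ^ 2 * iteratedDeriv 2 k t
      + (ν - 1) * (Real.sin t * Real.cos t * deriv k t) + Λ * (Real.sin t ^ 2 * k t) = 0) :
    HasEvenJet k (-(Λ / ν)) (3 * ν / (ν + 2) * (Λ / ν) ^ 2 - 2 * (ν - 1) / (ν + 2) * (Λ / ν)) := by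
  have hd1 : ContDiff ℝ ∞ (iteratedDeriv 1 k) := by
    rw [iteratedDeriv_eq_iterate]; exact ContDiff.iterate_deriv 1 hk
  have hd2 : ContDiff ℝ ∞ (iteratedDeriv 2 k) := by
    rw [iteratedDeriv_eq_iterate]; exact ContDiff.iterate_deriv 2 hk
  have hodd : ∀ m : ℕ, iteratedDeriv m k 0 = (-1) ^ m * iteratedDeriv m k 0 := fun m => by
    have h := iteratedDeriv_comp_neg m k 0
    simp only [heven, neg_zero, smul_eq_mul] at h
    exact h
  have h1 : iteratedDeriv 1 k 0 = 0 := by have := hodd 1; norm_num at this ⊢; linarith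
  have h3 : iteratedDeriv 3 k 0 = 0 := by have := hodd 3; norm_num at this ⊢; linarith
  -- The equation divided by sin t, which makes its first and third derivatives at 0 informative.
  -- Near 0 the division is legitimate for t ≠ 0, and at 0 itself `g` vanishes because k'(0) = 0.
  set g : ℝ → ℝ := fun t => Real.sin t * iteratedDeriv 2 k t
      + (ν - 1) * (Real.cos t * iteratedDeriv 1 k t) + Λ * (Real.sin t * k t) with hg
  have hg0 : g =ᶠ[nhds 0] fun _ => 0 := by
    have : ∀ᶠ t in nhds (0 : ℝ), t ∈ Set.Ioo (-Real.pi) Real.pi :=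
      Ioo_mem_nhds (by linarith [Real.pi_pos]) Real.pi_pos
    filter_upwards [this] with t ht
    by_cases h : t = 0
    · subst h; simp only [hg, h1]; simp
    · have hs : Real.sin t ≠ 0 := fun h' => h ((Real.sin_eq_zero_iff_of_lt_of_lt ht.1 ht.2).1 h')
      apply mul_left_cancel₀ hs
      rw [mul_zero, ← hode t, hg, ← iteratedDeriv_one]; ring
  have key : ∀ m : ℕ, iteratedDeriv m g 0 =
      iteratedDeriv m (Real.sin * iteratedDeriv 2 k) 0
      + (ν - 1) * iteratedDeriv m (Real.cos * iteratedDeriv 1 k) 0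
      + Λ * iteratedDeriv m (Real.sin * k) 0 := fun m => by
    have c1 : ContDiffAt ℝ m (Real.sin * iteratedDeriv 2 k) 0 :=
      contDiffAt_infty.1 (Real.contDiff_sin.mul hd2).contDiffAt m
    have c2 : ContDiffAt ℝ m (Real.cos * iteratedDeriv 1 k) 0 :=
      contDiffAt_infty.1 (Real.contDiff_cos.mul hd1).contDiffAt m
    have c3 : ContDiffAt ℝ m (Real.sin * k) 0 :=
      contDiffAt_infty.1 (Real.contDiff_sin.mul hk).contDiffAt m
    rw [← iteratedDeriv_const_mul _ c2, ← iteratedDeriv_const_mul _ c3,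
      ← iteratedDeriv_fun_add c1 (contDiffAt_const.mul c2),
      ← iteratedDeriv_fun_add (c1.add (contDiffAt_const.mul c2)) (contDiffAt_const.mul c3)]
    rfl
  have hzero : ∀ m : ℕ, iteratedDeriv m g 0 = 0 := fun m => by
    rw [hg0.iteratedDeriv_eq]; simp
  have hit : ∀ i m : ℕ, iteratedDeriv i (iteratedDeriv m k) 0 = iteratedDeriv (i + m) k 0 :=
    fun i m => by
      simp only [iteratedDeriv_eq_iterate, ← Function.iterate_add_apply]
  have hmul : ∀ (m : ℕ) (a b : ℝ → ℝ), ContDiff ℝ ∞ a → ContDiff ℝ ∞ b →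
      iteratedDeriv m (a * b) 0 = ∑ i ∈ .range (m + 1),
      m.choose i * iteratedDeriv i a 0 * iteratedDeriv (m - i) b 0 := fun m a b ha hb =>
    iteratedDeriv_mul (contDiffAt_infty.1 ha.contDiffAt m) (contDiffAt_infty.1 hb.contDiffAt m)
  have hs1 : iteratedDeriv 1 Real.sin 0 = 1 := by simp
  have hs2 : iteratedDeriv 2 Real.sin 0 = 0 := by simp [iteratedDeriv_succ]
  have hs3 : iteratedDeriv 3 Real.sin 0 = -1 := by simp [iteratedDeriv_succ]
  have hc1 : iteratedDeriv 1 Real.cos 0 = 0 := by simp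
  have hc2 : iteratedDeriv 2 Real.cos 0 = -1 := by simp [iteratedDeriv_succ]
  have hc3 : iteratedDeriv 3 Real.cos 0 = 0 := by simp [iteratedDeriv_succ]
  -- The first derivative reads ν k''(0) + Λ = 0; the third determines k''''(0), with coefficient ν
  -- + 2.
  have e1 := key 1
  have e3 := key 3
  have hch : Nat.choose 3 2 = 3 := rfl
  rw [hzero, hmul _ _ _ Real.contDiff_sin hd2, hmul _ _ _ Real.contDiff_cos hd1,
    hmul _ _ _ Real.contDiff_sin hk] at e1 e3
  simp only [Finset.sum_range_succ, Finset.sum_range_zero, hit, iteratedDeriv_zero, h0, h1, h3,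
    hs1, hs2, hs3, hc1, hc2, hc3, Nat.choose_self, Nat.choose_zero_right, Nat.choose_one_right,
    hch, Nat.reduceAdd, Nat.reduceSub, Real.sin_zero, Real.cos_zero] at e1 e3
  push_cast at e1 e3
  have h2 : iteratedDeriv 2 k 0 = -(Λ / ν) := by
    field_simp
    linarith
  refine ⟨hk, h0, h1, h2, h3, ?_⟩
  rw [h2] at e3
  have hν2 : ν + 2 ≠ 0 := by positivity
  have hΛ : Λ = ν * (Λ / ν) := by field_simp
  set ρ := Λ / ν
  rw [hΛ] at e3
  field_simp
  linarith

end Jets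

/-! ### The equation for zonal eigenfunctions and the profile of the kernel -/

section Zonal

variable {n l : ℕ}

lemma kernel_mem_eigenspace {f : Fin (eigenDim n l) → Sph n → ℝ}
    (hf : IsOrthonormalEigenbasis n l f) (x : Sph n) : kernel f x ∈ eigenspace n l := by
  have : kernel f x = ∑ i, (veronese f x i *
      √((sphereMeasure n).real Set.univ / eigenDim n l)) • f i := by
    ext y
    simp [kernel, veronese, mul_assoc]
  rw [this]
  exact Submodule.sum_mem _ fun i _ => Submodule.smul_mem _ _ (hf.mem i)

lemma radialExtension_of_norm_eq_one (f : Sph n → ℝ) {y : EuclideanSpace ℝ (Fin (n + 1))}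
    (hy : ‖y‖ = 1) : radialExtension f y = f ⟨y, by simpa using hy⟩ :=
  radialExtension_apply f ⟨y, by simpa using hy⟩

lemma radialExtension_smul_pos (f : Sph n → ℝ) {r : ℝ} (hr : 0 < r)
    (y : EuclideanSpace ℝ (Fin (n + 1))) : radialExtension f (r • y) = radialExtension f y := by
  by_cases hy : y = 0
  · simp [hy]
  · have : r • y ≠ 0 := smul_ne_zero hr.ne' hy
    simp only [radialExtension, hy, this, dite_false]
    congr 2
    rw [norm_smul, Real.norm_of_nonneg hr.le, mul_inv, smul_smul, mul_right_comm,
      inv_mul_cancel₀ hr.ne', one_mul]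

/-- A zonal Laplace eigenfunction satisfies a second order equation along great circles through
the pole. -/
lemma zonal_ode (b : OrthonormalBasis (Fin (n + 2)) ℝ (EuclideanSpace ℝ (Fin (n + 2))))
    {Z : Sph (n + 1) → ℝ} (hZ : Z ∈ eigenspace (n + 1) l)
    (hzonal : ∀ x y : Sph (n + 1), inner ℝ (b 0) x.1 = inner ℝ (b 0) y.1 → Z x = Z y)
    {k : ℝ → ℝ} (hk : k = fun t => radialExtension Z (Real.cos t • b 0 + Real.sin t • b 1)) (t : ℝ) :
    Real.sin t ^ 2 * iteratedDeriv 2 k t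
      + n * (Real.sin t * Real.cos t * deriv k t)
      + (l * (l + n) : ℝ) * (Real.sin t ^ 2 * k t) = 0 := by
  set g := radialExtension Z with hg
  let y : ℝ → EuclideanSpace ℝ (Fin (n + 2)) := fun t => Real.cos t • b 0 + Real.sin t • b 1
  let y' : ℝ → EuclideanSpace ℝ (Fin (n + 2)) := fun t => -Real.sin t • b 0 + Real.cos t • b 1
  have hb : ∀ i j, inner ℝ (b i) (b j) = if i = j then (1 : ℝ) else 0 :=
    orthonormal_iff_ite.1 b.orthonormal
  have h01 : ((0 : Fin (n + 2)) = 1) = False := by simp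
  have h10 : ((1 : Fin (n + 2)) = 0) = False := by simp
  have hdy : ∀ s, HasDerivAt y (y' s) s := fun s =>
    ((Real.hasDerivAt_cos s).smul_const (b 0)).add ((Real.hasDerivAt_sin s).smul_const (b 1))
  have hdy' : ∀ s, HasDerivAt y' (-y s) s := fun s => by
    convert! ((Real.hasDerivAt_sin s).neg.smul_const (b 0)).add
      ((Real.hasDerivAt_cos s).smul_const (b 1)) using 1
    simp [y]; abel
  have hy1 : ‖y t‖ = 1 := by
    have : ‖y t‖ ^ 2 = 1 := by
      rw [← real_inner_self_eq_norm_sq]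
      simp only [y, inner_add_left, inner_add_right, inner_smul_left, inner_smul_right, hb, h01, h10]
      simp
      linarith [Real.sin_sq_add_cos_sq t]
    nlinarith [norm_nonneg (y t)]
  have hy0 : y t ≠ 0 := norm_ne_zero_iff.1 (by rw [hy1]; exact one_ne_zero)
  have hgs : ContDiffAt ℝ ∞ g (y t) := contDiffAt_radialExtension hZ.1 hy0
  let D : EuclideanSpace ℝ (Fin (n + 2)) →L[ℝ] ℝ := fderiv ℝ g (y t)
  let B : EuclideanSpace ℝ (Fin (n + 2)) → EuclideanSpace ℝ (Fin (n + 2)) → ℝ :=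
    fun u v => fderiv ℝ (fderiv ℝ g) (y t) u v
  have hB : ∀ u, iteratedFDeriv ℝ 2 g (y t) ![u, u] = B u u := fun u => by
    rw [iteratedFDeriv_two_apply]; rfl
  have hsymm : ∀ u v, B u v = B v u := fun u v =>
    ((contDiffAt_infty.1 hgs 2).isSymmSndFDerivAt (by simp)) u v
  -- derivatives along the great circle
  have hk1 : deriv k t = D (y' t) := by
    rw [hk]; exact (hasDerivAt_comp_curve hgs (hdy t)).deriv
  have hk2 : iteratedDeriv 2 k t = B (y' t) (y' t) - D (y t) := by
    rw [hk, ← hB, sub_eq_add_neg, ← map_neg]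
    exact iteratedDeriv_two_comp_curve hgs hdy (hdy' t)
  -- derivatives in the radial direction
  have hrad : ∀ s, HasDerivAt (fun r : ℝ => (1 + r) • y t) (y t) s := fun s => by
    have := ((hasDerivAt_id s).const_add 1).smul_const (y t)
    rwa [one_smul] at this
  have hradc : (fun r : ℝ => g ((1 + r) • y t)) =ᶠ[nhds 0] fun _ => g (y t) := by
    have : ∀ᶠ r in nhds (0 : ℝ), -1 < r := lt_mem_nhds (by norm_num)
    filter_upwards [this] with r hr
    exact radialExtension_smul_pos Z (by linarith) _
  have hgs' : ContDiffAt ℝ ∞ g ((fun r : ℝ => (1 + r) • y t) 0) := by simpa using hgs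
  have hD0 : D (y t) = 0 := by
    have h := (hasDerivAt_comp_curve hgs' (hrad 0)).deriv
    rw [hradc.deriv_eq, deriv_const] at h
    simpa using h.symm
  have hB0 : B (y t) (y t) = 0 := by
    have h := iteratedDeriv_two_comp_curve hgs' hrad (hasDerivAt_const _ _)
    rw [hradc.iteratedDeriv_eq, iteratedDeriv_const] at h
    simp only [add_zero, one_smul, hB, map_zero] at h
    simpa using h.symm
  -- derivatives along rotations fixing the pole
  have hrot : ∀ j : Fin n, Real.sin t ^ 2 * B (b j.succ.succ) (b j.succ.succ) =
      Real.sin t * D (b 1) := by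
    intro j
    -- This circle keeps its inner product with the pole `b 0`, so `g` is constant on it; the
    -- vanishing second derivative yields the claim. The factors sin t are kept, so that the poles
    -- need no separate treatment.
    let c : ℝ → EuclideanSpace ℝ (Fin (n + 2)) := fun s => Real.cos t • b 0 +
      Real.sin t • (Real.cos s • b 1 + Real.sin s • b j.succ.succ)
    let c' : ℝ → EuclideanSpace ℝ (Fin (n + 2)) := fun s =>
      Real.sin t • (-Real.sin s • b 1 + Real.cos s • b j.succ.succ)
    have hj0 : ((0 : Fin (n + 2)) = j.succ.succ) = False := by simp [Fin.ext_iff]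
    have hj1 : ((1 : Fin (n + 2)) = j.succ.succ) = False := by simp [Fin.ext_iff]
    have hj0' : (j.succ.succ = (0 : Fin (n + 2))) = False := by simp [Fin.ext_iff]
    have hj1' : (j.succ.succ = (1 : Fin (n + 2))) = False := by simp [Fin.ext_iff]
    have hc : ∀ s, HasDerivAt c (c' s) s := fun s =>
      ((((Real.hasDerivAt_cos s).smul_const (b 1)).add
        ((Real.hasDerivAt_sin s).smul_const (b j.succ.succ))).const_smul (Real.sin t)).const_add _
    have hc' : HasDerivAt c' (Real.sin t • (-b 1)) 0 := by
      have := (((Real.hasDerivAt_sin 0).neg.smul_const (b 1)).add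
        ((Real.hasDerivAt_cos 0).smul_const (b j.succ.succ))).const_smul (Real.sin t)
      convert! this using 1
      simp
    have hc0 : c 0 = y t := by simp [c, y]
    have hc1 : ∀ s, ‖c s‖ = 1 := fun s => by
      have : ‖c s‖ ^ 2 = 1 := by
        rw [← real_inner_self_eq_norm_sq]
        simp only [c, inner_add_left, inner_add_right, inner_smul_left, inner_smul_right, hb, h01,
          h10, hj0, hj1, hj0', hj1']
        simp
        linear_combination (Real.sin t) ^ 2 * Real.sin_sq_add_cos_sq s + Real.sin_sq_add_cos_sq t
      nlinarith [norm_nonneg (c s)]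
    have hconst : (fun s => g (c s)) = fun _ => g (y t) := by
      ext s
      rw [hg, radialExtension_of_norm_eq_one Z (hc1 s), radialExtension_of_norm_eq_one Z hy1]
      apply hzonal
      simp only [c, y, inner_add_right, inner_smul_right, hb, h01, hj0]
      simp
    have h := iteratedDeriv_two_comp_curve (t := 0) (by rw [hc0]; exact hgs) hc hc'
    rw [hconst, hc0, hB, iteratedDeriv_const] at h
    have hc'0 : c' 0 = Real.sin t • b j.succ.succ := by simp [c']
    have h' : B (c' 0) (c' 0) = Real.sin t ^ 2 * B (b j.succ.succ) (b j.succ.succ) := by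
      rw [hc'0]; simp only [B, map_smul, smul_apply, smul_eq_mul]; ring
    have h'' : fderiv ℝ g (y t) (Real.sin t • -b 1) = -(Real.sin t * D (b 1)) := by
      simp [D]
    rw [h', h''] at h
    simp only [OfNat.ofNat_ne_zero, if_false] at h
    linarith
  have hb1 : D (b 1) = Real.cos t * D (y' t) := by
    have : b 1 = Real.sin t • y t + Real.cos t • y' t := by
      simp only [y, y', smul_add, smul_smul]
      have h1 : b 1 = (Real.sin t ^ 2 + Real.cos t ^ 2) • b 1 := by
        rw [Real.sin_sq_add_cos_sq, one_smul]
      nth_rewrite 1 [h1]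
      module
    rw [this, map_add, map_smul, map_smul, hD0]; simp
  -- The trace over the plane of `b 0`, `b 1` can be taken in the rotated basis `y t`, `y' t`, where
  -- the radial entry is 0.
  have hplane : B (b 0) (b 0) + B (b 1) (b 1) = B (y' t) (y' t) := by
    have h1 : B (y t) (y t) = Real.cos t ^ 2 * B (b 0) (b 0) +
        2 * (Real.cos t * Real.sin t) * B (b 0) (b 1) + Real.sin t ^ 2 * B (b 1) (b 1) := by
      have := hsymm (b 0) (b 1)
      simp only [B, y, map_add, map_smul, add_apply,
        smul_apply, smul_eq_mul] at this ⊢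
      rw [this]; ring
    have h2 : B (y' t) (y' t) = Real.sin t ^ 2 * B (b 0) (b 0) -
        2 * (Real.cos t * Real.sin t) * B (b 0) (b 1) + Real.cos t ^ 2 * B (b 1) (b 1) := by
      have := hsymm (b 0) (b 1)
      simp only [B, y', map_add, map_smul, add_apply,
        smul_apply, smul_eq_mul] at this ⊢
      rw [this]; ring
    have h3 := Real.sin_sq_add_cos_sq t
    rw [hB0] at h1
    linear_combination -h1 - h2 - (B (b 0) (b 0) + B (b 1) (b 1)) * h3
  have hlap := hZ.2 ⟨y t, by simpa using hy1⟩
  rw [sphereLaplacian, laplacian_eq_iteratedFDeriv_orthonormalBasis _ b] at hlap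
  simp only [← hg, hB] at hlap
  rw [Fin.sum_univ_succ, Fin.sum_univ_succ, ← add_assoc] at hlap
  have hkt : Z ⟨y t, by simpa using hy1⟩ = k t := by
    rw [hk]; exact (radialExtension_of_norm_eq_one Z hy1).symm
  have hsum : Real.sin t ^ 2 * ∑ j : Fin n, B (b j.succ.succ) (b j.succ.succ) =
      n * (Real.sin t * (Real.cos t * D (y' t))) := by
    rw [Finset.mul_sum, Finset.sum_congr rfl fun j _ => hrot j]
    simp [hb1]
  rw [hkt] at hlap
  have hlap' : -(B (b 0) (b 0) + B (b 1) (b 1) + ∑ j : Fin n, B (b j.succ.succ) (b j.succ.succ)) =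
    (l : ℝ) * (l + (n + 1 : ℕ) - 1) * k t := hlap
  rw [hplane] at hlap'
  push_cast at hlap'
  rw [hk1, hk2, hD0]
  linear_combination -Real.sin t ^ 2 * hlap' - hsum

/-- The kernel of a Veronese map is a function of the spherical distance, with a `4`-jet that is
determined by the Laplace eigenvalue. -/
theorem exists_profile (hn : 1 ≤ n) {f : Fin (eigenDim n l) → Sph n → ℝ}
    (hf : IsOrthonormalEigenbasis n l f) :
    ∃ k : ℝ → ℝ, HasEvenJet k (-rho n l) (lam n l) ∧
      ∀ (x y : Sph n) (t : ℝ), inner ℝ x.1 y.1 = Real.cos t → kernel f x y = k t := by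
  have hD := eigenDim_ne_zero hn hf
  obtain ⟨n, rfl⟩ : ∃ k, n = k + 1 := ⟨n - 1, by omega⟩
  let b := EuclideanSpace.basisFun (Fin (n + 2)) ℝ
  have hb : ∀ i j, inner ℝ (b i) (b j) = if i = j then (1 : ℝ) else 0 :=
    orthonormal_iff_ite.1 b.orthonormal
  let e : Sph (n + 1) := ⟨b 0, by simp [b]⟩
  let k : ℝ → ℝ := fun t => radialExtension (kernel f e) (Real.cos t • b 0 + Real.sin t • b 1)
  have hy1 : ∀ t, ‖Real.cos t • b 0 + Real.sin t • b 1‖ = 1 := fun t => by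
    have : ‖Real.cos t • b 0 + Real.sin t • b 1‖ ^ 2 = 1 := by
      rw [← real_inner_self_eq_norm_sq]
      simp only [inner_add_left, inner_add_right, inner_smul_left, inner_smul_right, hb]
      simp
      linarith [Real.sin_sq_add_cos_sq t]
    nlinarith [norm_nonneg (Real.cos t • b 0 + Real.sin t • b 1)]
  have hkey : ∀ (x y : Sph (n + 1)) (t : ℝ), inner ℝ x.1 y.1 = Real.cos t →
      kernel f x y = k t := fun x y t h => by
    simp only [k]
    rw [radialExtension_of_norm_eq_one _ (hy1 t)]
    apply kernel_eq_of_inner_eq hf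
    rw [h]
    simp only [e, inner_add_right, inner_smul_right, hb]
    simp
  have hmem := kernel_mem_eigenspace hf e
  have hode := zonal_ode b hmem (fun x y h => kernel_eq_of_inner_eq hf h) (k := k) rfl
  have hsm : ContDiff ℝ ∞ k := by
    rw [contDiff_iff_contDiffAt]
    intro t
    have hne : Real.cos t • b 0 + Real.sin t • b 1 ≠ 0 :=
      norm_ne_zero_iff.1 (by rw [hy1]; exact one_ne_zero)
    refine ContDiffAt.comp t (g := radialExtension (kernel f e))
      (contDiffAt_radialExtension hmem.1 hne) (ContDiff.contDiffAt ?_)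
    exact (Real.contDiff_cos.smul contDiff_const).add (Real.contDiff_sin.smul contDiff_const)
  -- The points at parameters t and -t have the same inner product with the pole.
  have heven : ∀ t, k (-t) = k t := fun t => by
    rw [← hkey e ⟨_, by simpa using hy1 t⟩ (-t), ← hkey e ⟨_, by simpa using hy1 t⟩ t] <;>
    · simp only [e, inner_add_right, inner_smul_right, hb]
      simp
  have h0 : k 0 = 1 := by
    rw [← hkey e e 0 (by simp), kernel_self hf hD]
  refine ⟨k, ?_, hkey⟩
  have := hasEvenJet_of_ode hsm heven h0 (ν := n + 1) (Λ := l * (l + n)) (by positivity)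
    (fun t => by simpa using hode t)
  convert! this using 1
  · simp [rho]; ring
  · simp [lam, rho]; ring

end Zonal

/-! ### Inner products of derivatives of curves -/

section InnerCurves

variable {V : Type*} [NormedAddCommGroup V] [InnerProductSpace ℝ V]

lemma inner_deriv_right {a b b' : ℝ → V} {φ φ' : ℝ → ℝ} (hb : ∀ t, HasDerivAt b (b' t) t)
    (hφ : ∀ t, HasDerivAt φ (φ' t) t) (h : ∀ s t, inner ℝ (a s) (b t) = φ (t - s)) (s t : ℝ) :
    inner ℝ (a s) (b' t) = φ' (t - s) := by
  have h1 : HasDerivAt (fun t => inner ℝ (a s) (b t)) (inner ℝ (a s) (b' t)) t := by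
    simpa using (hasDerivAt_const t (a s)).inner ℝ (hb t)
  have h2 : HasDerivAt (fun t => φ (t - s)) (φ' (t - s)) t :=
    (hφ (t - s)).comp_sub_const t s
  simp_rw [h] at h1
  exact h1.unique h2

lemma inner_deriv_left {a a' b : ℝ → V} {φ φ' : ℝ → ℝ} (ha : ∀ t, HasDerivAt a (a' t) t)
    (hφ : ∀ t, HasDerivAt φ (φ' t) t) (h : ∀ s t, inner ℝ (a s) (b t) = φ (t - s)) (s t : ℝ) :
    inner ℝ (a' s) (b t) = -φ' (t - s) := by
  have h1 : HasDerivAt (fun s => inner ℝ (a s) (b t)) (inner ℝ (a' s) (b t)) s := by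
    simpa using (ha s).inner ℝ (hasDerivAt_const s (b t))
  have h2 : HasDerivAt (fun s => φ (t - s)) (-φ' (t - s)) s :=
    (hφ (t - s)).comp_const_sub t s
  simp_rw [h] at h1
  exact h1.unique h2

lemma hasDerivAt_iteratedDeriv {W : Type*} [NormedAddCommGroup W] [NormedSpace ℝ W] {g : ℝ → W}
    (hg : ContDiff ℝ ∞ g) (m : ℕ) (t : ℝ) :
    HasDerivAt (iteratedDeriv m g) (iteratedDeriv (m + 1) g t) t := by
  rw [iteratedDeriv_succ]
  have h : ContDiff ℝ ∞ (iteratedDeriv m g) := by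
    rw [iteratedDeriv_eq_iterate]; exact ContDiff.iterate_deriv m hg
  exact (h.differentiable (by simp) t).hasDerivAt

/-- The first two derivatives of a curve `c` for which `⟨c(s), c(t)⟩` depends only on `t - s`. -/
lemma norm_sq_iteratedDeriv_of_inner_eq {c : ℝ → V} (hc : ContDiff ℝ ∞ c) {κ : ℝ → ℝ} {b d : ℝ}
    (hκ : HasEvenJet κ b d) (h : ∀ s t, inner ℝ (c s) (c t) = κ (t - s)) :
    ‖deriv c 0‖ ^ 2 = -b ∧ ‖iteratedDeriv 2 c 0‖ ^ 2 = d := by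
  have hd := hasDerivAt_iteratedDeriv hc
  have hk := hasDerivAt_iteratedDeriv hκ.contDiff
  have h0 : ∀ s t, inner ℝ (iteratedDeriv 0 c s) (iteratedDeriv 0 c t) = iteratedDeriv 0 κ (t - s) := by
    simpa using h
  -- Each derivative in t differentiates κ; each derivative in s does so with a minus sign. Hence
  -- ⟨c', c'⟩ = -κ'' and ⟨c'', c''⟩ = κ''''.
  have h1 := inner_deriv_right (hd 0) (hk 0) h0
  have h2 := inner_deriv_right (hd 1) (hk 1) h1
  have h11 := inner_deriv_left (hd 0) (hk 1) h1 0 0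
  have h12 := inner_deriv_left (hd 0) (hk 2) h2
  have h22 := inner_deriv_left (φ := fun t => -iteratedDeriv 3 κ t) (hd 1)
    (fun t => (hk 3 t).neg) h12 0 0
  simp only [zero_add, Nat.reduceAdd, sub_zero, neg_neg] at h11 h22
  rw [real_inner_self_eq_norm_sq] at h11 h22
  rw [← iteratedDeriv_one, h11, h22, hκ.two, hκ.four]
  exact ⟨rfl, rfl⟩

/-- First and second derivatives of two curves are orthogonal if their inner products are
invariant under simultaneous reversal of the curves. -/
lemma inner_deriv_iteratedDeriv_eq_zero {a b : ℝ → V} (ha : ContDiff ℝ ∞ a)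
    (hb : ContDiff ℝ ∞ b) (h : ∀ s t, inner ℝ (a (-s)) (b (-t)) = inner ℝ (a s) (b t)) :
    inner ℝ (deriv a 0) (iteratedDeriv 2 b 0) = 0 := by
  -- The function s ↦ ⟨a(s), b''(0)⟩ is even, since a second derivative at 0 ignores reversal of t;
  -- its derivative at 0 therefore vanishes.
  have h1 : ∀ s, inner ℝ (a (-s)) (iteratedDeriv 2 b 0) = inner ℝ (a s) (iteratedDeriv 2 b 0) := by
    intro s
    have key : ∀ v : V, iteratedDeriv 2 (fun t => inner ℝ v (b t)) 0 =
        inner ℝ v (iteratedDeriv 2 b 0) := fun v => by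
      have e1 : ∀ t, HasDerivAt (fun t => inner ℝ v (b t)) (inner ℝ v (iteratedDeriv 1 b t)) t :=
        fun t => by
          simpa using (hasDerivAt_const t v).inner ℝ (hasDerivAt_iteratedDeriv hb 0 t)
      refine iteratedDeriv_two_eq (Filter.Eventually.of_forall e1) ?_
      simpa using (hasDerivAt_const 0 v).inner ℝ (hasDerivAt_iteratedDeriv hb 1 0)
    have h2 : (fun t => inner ℝ (a (-s)) (b t)) = fun t => inner ℝ (a s) (b (-t)) := by
      ext t; rw [← h, neg_neg]
    rw [← key, ← key, h2]
    have := iteratedDeriv_comp_neg 2 (fun t => inner ℝ (a s) (b t)) 0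
    simpa using this
  have e1 : HasDerivAt (fun s => inner ℝ (a s) (iteratedDeriv 2 b 0))
      (inner ℝ (deriv a 0) (iteratedDeriv 2 b 0)) 0 := by
    simpa using ((ha.differentiable (by simp) 0).hasDerivAt).inner ℝ
      (hasDerivAt_const 0 (iteratedDeriv 2 b 0))
  have e2 := HasDerivAt.comp_const_sub (f := fun s => inner ℝ (a s) (iteratedDeriv 2 b 0))
    (0 : ℝ) 0 (by simpa using e1)
  simp only [zero_sub, h1] at e2
  linarith [e1.unique e2]

end InnerCurves

/-! ### The map F along products of great circles -/

section Ambient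

variable {M : ℕ} {n : Fin M → ℕ}

/-- The extension of `sumMap` to the ambient Euclidean space which is constant on rays in each
factor. -/
def ambientMap (f : ∀ m l, Fin (eigenDim (n m) l) → Sph (n m) → ℝ) (α : (Fin M → ℕ) →₀ ℝ)
    (y : ∀ m, EuclideanSpace ℝ (Fin (n m + 1))) : Target n α :=
  WithLp.toLp 2 fun k => √(α k.1.1) * ∏ m,
    (√((sphereMeasure (n m)).real Set.univ / eigenDim (n m) (k.1.1 m)) *
      radialExtension (f m (k.1.1 m) (k.2 m)) (y m))

variable {f : ∀ m l, Fin (eigenDim (n m) l) → Sph (n m) → ℝ} {α : (Fin M → ℕ) →₀ ℝ}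

lemma ambientMap_coe (x : ProdSph n) : ambientMap f α (fun m => (x m).1) = sumMap f α x := by
  simp only [ambientMap, sumMap, tensorVeronese, veronese, radialExtension_apply]

lemma contDiffAt_ambientMap (hf : ∀ m l, IsOrthonormalEigenbasis (n m) l (f m l))
    {y : ∀ m, EuclideanSpace ℝ (Fin (n m + 1))} (hy : ∀ m, y m ≠ 0) :
    ContDiffAt ℝ ∞ (ambientMap f α) y := by
  rw [contDiffAt_euclidean]
  intro k
  refine contDiffAt_const.mul (contDiffAt_prod fun m _ => contDiffAt_const.mul ?_)
  exact ContDiffAt.comp y (g := radialExtension (f m (k.1.1 m) (k.2 m)))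
    (f := fun y : ∀ m, EuclideanSpace ℝ (Fin (n m + 1)) => y m)
    (contDiffAt_radialExtension ((hf m _).mem _).1 (hy m)) 
      (ContinuousLinearMap.proj (R := ℝ) (φ := fun m => EuclideanSpace ℝ (Fin (n m + 1)))
        m).contDiff.contDiffAt

/-- Inner products of tensors are products of inner products, here as the expansion of a product of
sums; the weights √α multiply to α. -/
lemma inner_sumMap (hα : ∀ l, 0 ≤ α l) (x y : ProdSph n) :
    inner ℝ (sumMap f α x) (sumMap f α y) =
      ∑ l ∈ α.support, α l * ∏ m, kernel (f m (l m)) (x m) (y m) := by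
  rw [PiLp.inner_apply, Fintype.sum_sigma, ← Finset.sum_coe_sort α.support]
  refine Finset.sum_congr rfl fun l _ => ?_
  simp only [kernel]
  rw [Finset.prod_univ_sum, Fintype.piFinset_univ, Finset.mul_sum]
  refine Finset.sum_congr rfl fun i _ => ?_
  simp only [sumMap, tensorVeronese, Finset.prod_mul_distrib]
  rw [RCLike.inner_apply, conj_trivial, mul_mul_mul_comm, Real.mul_self_sqrt (hα _),
    mul_comm (∏ m, veronese (f m (l.1 m)) (y m) (i m))]

/-- The product of the great circles through `p m` with initial velocities `u m`. -/
def geodesic (p u : ∀ m, EuclideanSpace ℝ (Fin (n m + 1))) (t : ℝ)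
    (m : Fin M) : EuclideanSpace ℝ (Fin (n m + 1)) :=
  -- If `u m = 0`, the convention 0⁻¹ = 0 is harmless: this factor stays at `p m`.
  Real.cos (‖u m‖ * t) • p m + Real.sin (‖u m‖ * t) • (‖u m‖⁻¹ • u m)

/-- The velocity of `geodesic`. -/
def geodesicDeriv (p u : ∀ m, EuclideanSpace ℝ (Fin (n m + 1))) (t : ℝ)
    (m : Fin M) : EuclideanSpace ℝ (Fin (n m + 1)) :=
  (-Real.sin (‖u m‖ * t) * ‖u m‖) • p m + (Real.cos (‖u m‖ * t) * ‖u m‖) • (‖u m‖⁻¹ • u m)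

lemma hasDerivAt_geodesic (p u : ∀ m, EuclideanSpace ℝ (Fin (n m + 1))) (t : ℝ) :
    HasDerivAt (geodesic p u) (geodesicDeriv p u t) t := by
  rw [hasDerivAt_pi]
  intro m
  have h : HasDerivAt (fun t => ‖u m‖ * t) ‖u m‖ t := by
    simpa using (hasDerivAt_id t).const_mul ‖u m‖
  exact (h.cos.smul_const _).add (h.sin.smul_const _)

lemma hasDerivAt_geodesicDeriv (p u : ∀ m, EuclideanSpace ℝ (Fin (n m + 1))) :
    HasDerivAt (geodesicDeriv p u) (fun m => -(‖u m‖ ^ 2) • p m) 0 := by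
  rw [hasDerivAt_pi]
  intro m
  have h : HasDerivAt (fun t => ‖u m‖ * t) ‖u m‖ (0 : ℝ) := by
    simpa using (hasDerivAt_id (0 : ℝ)).const_mul ‖u m‖
  convert! ((h.sin.neg.mul_const ‖u m‖).smul_const (p m)).add
    ((h.cos.mul_const ‖u m‖).smul_const (‖u m‖⁻¹ • u m)) using 1
  simp [sq]

lemma geodesic_zero (p u : ∀ m, EuclideanSpace ℝ (Fin (n m + 1))) : geodesic p u 0 = p := by
  ext1 m; simp [geodesic]

lemma norm_smul_inv_norm_smul {E : Type*} [NormedAddCommGroup E] [NormedSpace ℝ E] (u : E) :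
    ‖u‖ • (‖u‖⁻¹ • u) = u := by
  by_cases h : u = 0
  · simp [h]
  · rw [smul_smul, mul_inv_cancel₀ (norm_ne_zero_iff.2 h), one_smul]

lemma geodesicDeriv_zero (p u : ∀ m, EuclideanSpace ℝ (Fin (n m + 1))) :
    geodesicDeriv p u 0 = u := by
  ext1 m; simp [geodesicDeriv, norm_smul_inv_norm_smul]

lemma inner_geodesic {p u : ∀ m, EuclideanSpace ℝ (Fin (n m + 1))} (hp : ∀ m, ‖p m‖ = 1)
    (hu : ∀ m, inner ℝ (u m) (p m) = 0) (s t : ℝ) (m : Fin M) :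
    inner ℝ (geodesic p u s m) (geodesic p u t m) = Real.cos (‖u m‖ * (t - s)) := by
  have hu' : inner ℝ (p m) (u m) = 0 := by rw [real_inner_comm]; exact hu m
  rw [mul_sub, Real.cos_sub]
  simp only [geodesic, inner_add_left, inner_add_right, inner_smul_left, inner_smul_right, hu m,
    hu', real_inner_self_eq_norm_sq, hp m]
  by_cases h : ‖u m‖ = 0
  · simp [h]
  · simp only [conj_trivial]
    field_simp
    simp
    ring

variable (n α) in
/-- The quadratic form of `matA` as an expectation. -/
lemma dotProduct_matA (U : Fin M → ℝ) : dotProduct U ((matA n α).mulVec U) =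
    ∑ l ∈ α.support, α l * (∑ m, lam (n m) (l m) * U m ^ 2 +
      3 * ((∑ m, rho (n m) (l m) * U m) ^ 2 - ∑ m, (rho (n m) (l m) * U m) ^ 2)) := by
  have h1 : ∀ l : Fin M → ℕ, (∑ m, lam (n m) (l m) * U m ^ 2 +
      3 * ((∑ m, rho (n m) (l m) * U m) ^ 2 - ∑ m, (rho (n m) (l m) * U m) ^ 2)) =
      ∑ a, ∑ b, U a * ((if a = b then lam (n a) (l a) else
        3 * (rho (n a) (l a) * rho (n b) (l b))) * U b) := fun l => by
    have : ∀ a b, U a * ((if a = b then lam (n a) (l a) else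
        3 * (rho (n a) (l a) * rho (n b) (l b))) * U b) =
        3 * ((rho (n a) (l a) * U a) * (rho (n b) (l b) * U b)) +
        (if a = b then lam (n a) (l a) * U a ^ 2 - 3 * (rho (n a) (l a) * U a) ^ 2 else 0) := by
      intro a b
      split_ifs with h
      · subst h; ring
      · ring
    simp_rw [this, Finset.sum_add_distrib, ← Finset.mul_sum]
    simp only [Finset.sum_ite_eq, Finset.mem_univ, if_true, Finset.sum_sub_distrib]
    rw [sq (∑ m, rho (n m) (l m) * U m), Finset.sum_mul_sum]
    simp only [Finset.mul_sum, mul_sub]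
    ring
  simp_rw [h1, dotProduct, Matrix.mulVec, dotProduct, Finset.mul_sum]
  conv_rhs => rw [Finset.sum_comm]
  refine Finset.sum_congr rfl fun a _ => ?_
  conv_rhs => rw [Finset.sum_comm]
  refine Finset.sum_congr rfl fun b _ => ?_
  simp only [matA, Matrix.of_apply, expect]
  split_ifs
  · rw [Finset.sum_mul, Finset.mul_sum]
    exact Finset.sum_congr rfl fun l _ => by ring
  · rw [Finset.mul_sum, Finset.sum_mul, Finset.mul_sum]
    exact Finset.sum_congr rfl fun l _ => by ring

lemma dotProduct_vecG (U : Fin M → ℝ) :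
    dotProduct (vecG n α) U = ∑ l ∈ α.support, α l * ∑ m, rho (n m) (l m) * U m := by
  simp only [dotProduct, vecG, expect, Finset.sum_mul, Finset.mul_sum]
  rw [Finset.sum_comm]
  exact Finset.sum_congr rfl fun l _ => Finset.sum_congr rfl fun m _ => by ring

lemma norm_sumMap (hn : ∀ m, 1 ≤ n m) (hf : ∀ m l, IsOrthonormalEigenbasis (n m) l (f m l))
    (hα : ∀ l, 0 ≤ α l) (hα1 : ∑ l ∈ α.support, α l = 1) (x : ProdSph n) :
    ‖sumMap f α x‖ = 1 := by
  have h : ‖sumMap f α x‖ ^ 2 = 1 := by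
    rw [← real_inner_self_eq_norm_sq, inner_sumMap hα, ← hα1]
    refine Finset.sum_congr rfl fun l _ => ?_
    rw [Finset.prod_eq_one fun m _ => kernel_self (hf m _) (eigenDim_ne_zero (hn m) (hf m _)) _,
      mul_one]
  nlinarith [norm_nonneg (sumMap f α x)]

/-- The pullback metric and the squared length of the acceleration of geodesics. -/
theorem norm_sq_iteratedDeriv_geodesic (hn : ∀ m, 1 ≤ n m)
    (hf : ∀ m l, IsOrthonormalEigenbasis (n m) l (f m l))
    (hα : ∀ l, 0 ≤ α l) (hα1 : ∑ l ∈ α.support, α l = 1)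
    {p u : ∀ m, EuclideanSpace ℝ (Fin (n m + 1))} (hp : ∀ m, ‖p m‖ = 1)
    (hu : ∀ m, inner ℝ (u m) (p m) = 0) :
    ‖deriv (fun t => ambientMap f α (geodesic p u t)) 0‖ ^ 2 =
      dotProduct (vecG n α) (fun m => ‖u m‖ ^ 2) ∧
    ‖iteratedDeriv 2 (fun t => ambientMap f α (geodesic p u t)) 0‖ ^ 2 =
      dotProduct (fun m => ‖u m‖ ^ 2) ((matA n α).mulVec fun m => ‖u m‖ ^ 2) := by
  choose k hk hker using fun m l => exists_profile (hn m) (hf m l)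
  have hnorm : ∀ t m, ‖geodesic p u t m‖ = 1 := fun t m => by
    have := inner_geodesic hp hu t t m
    rw [real_inner_self_eq_norm_sq, sub_self, mul_zero, Real.cos_zero] at this
    nlinarith [norm_nonneg (geodesic p u t m)]
  have hne : ∀ t m, geodesic p u t m ≠ 0 := fun t m =>
    norm_ne_zero_iff.1 (by rw [hnorm]; exact one_ne_zero)
  let γ : ℝ → ProdSph n := fun t m => ⟨geodesic p u t m, by simpa using hnorm t m⟩
  -- The jet of κ(t) = 𝔼 ∏ k_m(|u_m| t): rescale each profile, multiply over the factors, average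
  -- over α.
  have hjet := HasEvenJet.sum α.support hα1 fun l : Fin M → ℕ =>
    HasEvenJet.prod Finset.univ fun m => (hk m (l m)).comp_mul ‖u m‖
  have hsm : ContDiff ℝ ∞ fun t => ambientMap f α (geodesic p u t) := by
    rw [contDiff_iff_contDiffAt]
    intro t
    refine ContDiffAt.comp t (g := ambientMap f α) (contDiffAt_ambientMap hf (hne t))
      (ContDiff.contDiffAt ?_)
    rw [contDiff_pi]
    intro m
    have h : ContDiff ℝ ∞ fun t => ‖u m‖ * t := contDiff_const.mul contDiff_id
    exact (h.cos.smul contDiff_const).add (h.sin.smul contDiff_const)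
  have h := norm_sq_iteratedDeriv_of_inner_eq hsm hjet fun s t => by
    have e : ∀ t, ambientMap f α (geodesic p u t) = sumMap f α (γ t) := fun t =>
      ambientMap_coe (γ t)
    rw [e, e, inner_sumMap hα]
    refine Finset.sum_congr rfl fun l _ => ?_
    congr 1
    exact Finset.prod_congr rfl fun m _ => hker m (l m) _ _ _ (inner_geodesic hp hu s t m)
  rw [h.1, h.2, dotProduct_vecG, dotProduct_matA]
  constructor
  · rw [← Finset.sum_neg_distrib]
    refine Finset.sum_congr rfl fun l _ => ?_
    rw [← mul_neg, ← Finset.sum_neg_distrib]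
    congr 1
    exact Finset.sum_congr rfl fun m _ => by ring
  · refine Finset.sum_congr rfl fun l _ => ?_
    have e1 : ∑ m, -rho (n m) (l m) * ‖u m‖ ^ 2 = -∑ m, rho (n m) (l m) * ‖u m‖ ^ 2 := by
      rw [← Finset.sum_neg_distrib]
      exact Finset.sum_congr rfl fun m _ => by ring
    rw [e1, neg_sq]
    congr 2
    · exact Finset.sum_congr rfl fun m _ => by ring
    · congr 2
      exact Finset.sum_congr rfl fun m _ => by ring

end Ambient

/-! ### Stereographic charts and the second fundamental form -/

section Charts

lemma chartAt_sphere_target {n : ℕ} (x : Sph n) :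
    (chartAt (EuclideanSpace ℝ (Fin n)) x).target = Set.univ := by
  have := Fact.mk (finrank_euclideanSpace_fin (𝕜 := ℝ) (n := n + 1))
  exact stereographic'_target (-x)

/-- The preferred chart at `x` is stereographic projection from `-x`, so `x` sits at its centre; `ι`
identifies the model space isometrically with directions orthogonal to `x`. -/
lemma chartAt_sphere_symm {n : ℕ} (x : Sph n) :
    ∃ ι : EuclideanSpace ℝ (Fin n) →ₗᵢ[ℝ] EuclideanSpace ℝ (Fin (n + 1)),
      (∀ w, inner ℝ (ι w) x.1 = 0) ∧ ∀ w, ((chartAt (EuclideanSpace ℝ (Fin n)) x).symm w).1 =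
        (‖w‖ ^ 2 + 4)⁻¹ • ((4 : ℝ) • ι w + (4 - ‖w‖ ^ 2) • x.1) := by
  have := Fact.mk (finrank_euclideanSpace_fin (𝕜 := ℝ) (n := n + 1))
  let U := (OrthonormalBasis.fromOrthogonalSpanSingleton (𝕜 := ℝ) n
    (ne_zero_of_mem_unit_sphere (-x))).repr
  refine ⟨(Submodule.subtypeₗᵢ _).comp U.symm.toLinearIsometry, fun w => ?_, fun w => ?_⟩
  · have h : ((U.symm w : _) : EuclideanSpace ℝ (Fin (n + 1))) ∈
      (ℝ ∙ ((-x : Sph n) : EuclideanSpace ℝ (Fin (n + 1))))ᗮ := (U.symm w).2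
    rw [Submodule.mem_orthogonal_singleton_iff_inner_left] at h
    have h' : inner ℝ ((U.symm w : _) : EuclideanSpace ℝ (Fin (n + 1))) x.1 = 0 := by simpa using h
    exact h'
  · have h := stereographic'_symm_apply (-x) w
    have hn : ‖((U.symm w : _) : EuclideanSpace ℝ (Fin (n + 1)))‖ = ‖w‖ :=
      U.symm.norm_map w
    change ((stereographic' n (-x)).symm w).1 = _
    rw [h]
    change (‖((U.symm w : _) : EuclideanSpace ℝ (Fin (n + 1)))‖ ^ 2 + 4)⁻¹ • (4 : ℝ) •
      ((U.symm w : _) : EuclideanSpace ℝ (Fin (n + 1))) +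
      (‖((U.symm w : _) : EuclideanSpace ℝ (Fin (n + 1)))‖ ^ 2 + 4)⁻¹ •
      (‖((U.symm w : _) : EuclideanSpace ℝ (Fin (n + 1)))‖ ^ 2 - 4) • (-x.1) = _
    rw [hn]
    change _ = (‖w‖ ^ 2 + 4)⁻¹ • ((4 : ℝ) • ((U.symm w : _) : EuclideanSpace ℝ (Fin (n + 1))) +
      (4 - ‖w‖ ^ 2) • x.1)
    module

lemma chartAt_sphere_self {n : ℕ} (x : Sph n) : chartAt (EuclideanSpace ℝ (Fin n)) x x = 0 := by
  obtain ⟨ι, -, h⟩ := chartAt_sphere_symm x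
  have h0 : (chartAt (EuclideanSpace ℝ (Fin n)) x).symm 0 = x := by
    ext1
    rw [h]; simp
  have := (chartAt (EuclideanSpace ℝ (Fin n)) x).right_inv (x := 0)
    (by rw [chartAt_sphere_target]; trivial)
  rwa [h0] at this

variable {M : ℕ} {n : Fin M → ℕ}

lemma extChartAt_prodSph_self (p : ProdSph n) : extChartAt (prodModel n) p p = 0 := by
  ext1 m
  exact chartAt_sphere_self (p m)

lemma range_prodModel : Set.range (prodModel n) = Set.univ :=
  Set.eq_univ_of_forall fun w => ⟨w, rfl⟩

/-- `sumMap` in the preferred chart at `p`. -/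
def chartMap (f : ∀ m l, Fin (eigenDim (n m) l) → Sph (n m) → ℝ) (α : (Fin M → ℕ) →₀ ℝ)
    (p : ProdSph n) : (∀ m, EuclideanSpace ℝ (Fin (n m))) → Target n α :=
  sumMap f α ∘ (extChartAt (prodModel n) p).symm

variable {f : ∀ m l, Fin (eigenDim (n m) l) → Sph (n m) → ℝ} {α : (Fin M → ℕ) →₀ ℝ}

/-- Inverse stereographic projection in each factor, in terms of isometric embeddings `ι` of the
tangent spaces. -/
def stereoInv (p : ProdSph n)
    (ι : ∀ m, EuclideanSpace ℝ (Fin (n m)) →ₗᵢ[ℝ] EuclideanSpace ℝ (Fin (n m + 1)))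
    (w : ∀ m, EuclideanSpace ℝ (Fin (n m))) (m : Fin M) : EuclideanSpace ℝ (Fin (n m + 1)) :=
  (‖w m‖ ^ 2 + 4)⁻¹ • ((4 : ℝ) • ι m (w m) + (4 - ‖w m‖ ^ 2) • (p m).1)

lemma contDiff_stereoInv (p : ProdSph n)
    (ι : ∀ m, EuclideanSpace ℝ (Fin (n m)) →ₗᵢ[ℝ] EuclideanSpace ℝ (Fin (n m + 1))) :
    ContDiff ℝ ∞ (stereoInv p ι) := by
  rw [contDiff_pi]
  intro m
  have hpr : ContDiff ℝ ∞ fun w : ∀ m, EuclideanSpace ℝ (Fin (n m)) => w m :=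
    (ContinuousLinearMap.proj (R := ℝ) (φ := fun m => EuclideanSpace ℝ (Fin (n m))) m).contDiff
  have h0 : ContDiff ℝ ∞ fun w : ∀ m, EuclideanSpace ℝ (Fin (n m)) => ‖w m‖ ^ 2 := hpr.norm_sq ℝ
  have h1 : ContDiff ℝ ∞ fun w : ∀ m, EuclideanSpace ℝ (Fin (n m)) => (‖w m‖ ^ 2 + 4)⁻¹ :=
    (h0.add contDiff_const).inv fun w => by positivity
  have h2 : ContDiff ℝ ∞ fun w : ∀ m, EuclideanSpace ℝ (Fin (n m)) => ι m (w m) :=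
    (ι m).toContinuousLinearMap.contDiff.comp hpr
  exact h1.fun_smul ((contDiff_const.fun_smul h2).add
    ((contDiff_const.sub h0).fun_smul contDiff_const))

/-- The straight line through the origin with velocity `u`, in the inverse stereographic chart. -/
def stereoLine {E : Type*} [NormedAddCommGroup E] [NormedSpace ℝ E] (p u : E) (t : ℝ) : E :=
  ((t * ‖u‖) ^ 2 + 4)⁻¹ • ((4 : ℝ) • t • u + (4 - (t * ‖u‖) ^ 2) • p)

/-- The velocity of `stereoLine`. -/
def stereoLineDeriv {E : Type*} [NormedAddCommGroup E] [NormedSpace ℝ E] (p u : E) (t : ℝ) : E :=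
  ((16 - 4 * t ^ 2 * ‖u‖ ^ 2) * (((t * ‖u‖) ^ 2 + 4) ^ 2)⁻¹) • u +
    (-16 * t * ‖u‖ ^ 2 * (((t * ‖u‖) ^ 2 + 4) ^ 2)⁻¹) • p

lemma hasDerivAt_stereoLine {E : Type*} [NormedAddCommGroup E] [NormedSpace ℝ E] (p u : E) (t : ℝ) :
    HasDerivAt (stereoLine p u) (stereoLineDeriv p u t) t := by
  have hq : HasDerivAt (fun t : ℝ => (t * ‖u‖) ^ 2) (2 * t * ‖u‖ ^ 2) t := by
    convert! ((hasDerivAt_id t).mul_const ‖u‖).pow 2 using 1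
    simp; ring
  have hpos : (t * ‖u‖) ^ 2 + 4 ≠ 0 := by positivity
  have h := ((hq.add_const 4).inv hpos).smul
    (((((hasDerivAt_id t).smul_const u).const_smul (4 : ℝ))).add ((hq.const_sub 4).smul_const p))
  convert! h using 1
  simp only [stereoLineDeriv, id, Pi.inv_apply, Pi.add_apply, Pi.smul_apply]
  match_scalars <;> field_simp <;> ring

/-- The acceleration at 0 is the same as that of the great circle with velocity `u`, see
`hasDerivAt_geodesicDeriv`; hence both curves give the same second derivatives. -/
lemma hasDerivAt_stereoLineDeriv {E : Type*} [NormedAddCommGroup E] [NormedSpace ℝ E] (p u : E) :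
    HasDerivAt (stereoLineDeriv p u) (-(‖u‖ ^ 2) • p) 0 := by
  have hq : HasDerivAt (fun t : ℝ => (t * ‖u‖) ^ 2) 0 0 := by
    convert! ((hasDerivAt_id (0 : ℝ)).mul_const ‖u‖).pow 2 using 1
    simp
  have hpos : ((0 * ‖u‖) ^ 2 + 4) ^ 2 ≠ 0 := by positivity
  have hi := ((hq.add_const 4).pow 2).inv hpos
  have h1 : HasDerivAt (fun t : ℝ => 16 - 4 * t ^ 2 * ‖u‖ ^ 2) 0 0 := by
    convert! ((((hasDerivAt_id (0 : ℝ)).pow 2).const_mul 4).mul_const (‖u‖ ^ 2)).const_sub 16 using 1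
    simp
  have h2 : HasDerivAt (fun t : ℝ => -16 * t * ‖u‖ ^ 2) (-16 * ‖u‖ ^ 2) 0 := by
    convert! ((hasDerivAt_id (0 : ℝ)).const_mul (-16)).mul_const (‖u‖ ^ 2) using 1
    simp
  convert! ((h1.mul hi).smul_const u).add ((h2.mul hi).smul_const p) using 1
  simp
  match_scalars
  norm_num
  ring

lemma exists_chartMap_eq (p : ProdSph n) :
    ∃ ι : ∀ m, EuclideanSpace ℝ (Fin (n m)) →ₗᵢ[ℝ] EuclideanSpace ℝ (Fin (n m + 1)),
      (∀ m w, inner ℝ (ι m w) (p m).1 = 0) ∧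
      ∀ w m, ((extChartAt (prodModel n) p).symm w m).1 = stereoInv p ι w m := by
  choose ι h1 h2 using fun m => chartAt_sphere_symm (p m)
  exact ⟨ι, h1, fun w m => h2 m (w m)⟩

lemma chartMap_eq_ambientMap {p : ProdSph n}
    {ι : ∀ m, EuclideanSpace ℝ (Fin (n m)) →ₗᵢ[ℝ] EuclideanSpace ℝ (Fin (n m + 1))}
    (h : ∀ w m, ((extChartAt (prodModel n) p).symm w m).1 = stereoInv p ι w m) :
    chartMap f α p = fun w => ambientMap f α (stereoInv p ι w) := by
  ext1 w
  have : stereoInv p ι w = fun m => ((extChartAt (prodModel n) p).symm w m).1 := by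
    ext1 m; rw [h]
  rw [this, ambientMap_coe]
  rfl

lemma contDiff_chartMap (hf : ∀ m l, IsOrthonormalEigenbasis (n m) l (f m l)) (p : ProdSph n) :
    ContDiff ℝ ∞ (chartMap f α p) := by
  obtain ⟨ι, -, h⟩ := exists_chartMap_eq p
  rw [chartMap_eq_ambientMap h, contDiff_iff_contDiffAt]
  intro w
  refine ContDiffAt.comp w (g := ambientMap f α) (contDiffAt_ambientMap hf fun m => ?_)
    (contDiff_stereoInv p ι).contDiffAt
  rw [← h]
  exact ne_zero_of_mem_unit_sphere _

/-- Changing the sign of the chart coordinate reflects each sphere in the axis through `p m`. This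
preserves inner products of points, hence all kernels. -/
lemma inner_chartMap_neg (hf : ∀ m l, IsOrthonormalEigenbasis (n m) l (f m l))
    (hα : ∀ l, 0 ≤ α l) (p : ProdSph n) (v w : ∀ m, EuclideanSpace ℝ (Fin (n m))) :
    inner ℝ (chartMap f α p (-v)) (chartMap f α p (-w)) =
      inner ℝ (chartMap f α p v) (chartMap f α p w) := by
  obtain ⟨ι, hι, h⟩ := exists_chartMap_eq p
  have hι' : ∀ m w, inner ℝ (p m).1 (ι m w) = 0 := fun m w => by
    rw [real_inner_comm]; exact hι m w
  simp only [chartMap, Function.comp_apply]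
  rw [inner_sumMap hα, inner_sumMap hα]
  refine Finset.sum_congr rfl fun l _ => ?_
  congr 1
  refine Finset.prod_congr rfl fun m _ => ?_
  apply kernel_eq_of_inner_eq (hf m (l m))
  rw [h, h, h, h]
  simp [stereoInv, inner_add_left, inner_add_right, inner_smul_left, inner_smul_right, hι, hι']

lemma hasDerivAt_smul_const {E : Type*} [NormedAddCommGroup E] [NormedSpace ℝ E] (u : E) (t : ℝ) :
    HasDerivAt (fun t : ℝ => t • u) u t := by
  simpa using (hasDerivAt_id t).smul_const u

lemma deriv_chartMap_line (hf : ∀ m l, IsOrthonormalEigenbasis (n m) l (f m l)) (p : ProdSph n)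
    (u : ∀ m, EuclideanSpace ℝ (Fin (n m))) :
    deriv (fun t : ℝ => chartMap f α p (t • u)) 0 = fderiv ℝ (chartMap f α p) 0 u ∧
    iteratedDeriv 2 (fun t : ℝ => chartMap f α p (t • u)) 0 =
      iteratedFDeriv ℝ 2 (chartMap f α p) 0 ![u, u] := by
  have hs := (contDiff_chartMap (α := α) hf p).contDiffAt (x := (0 : ℝ) • u)
  constructor
  · simpa using (hasDerivAt_comp_curve hs (hasDerivAt_smul_const u 0)).deriv
  · simpa using iteratedDeriv_two_comp_curve hs (hasDerivAt_smul_const u) (hasDerivAt_const _ _)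

/-- The first fundamental form of `sumMap`, and the squared length of its second derivative in the
preferred chart. -/
theorem norm_sq_fderiv_chartMap (hn : ∀ m, 1 ≤ n m)
    (hf : ∀ m l, IsOrthonormalEigenbasis (n m) l (f m l))
    (hα : ∀ l, 0 ≤ α l) (hα1 : ∑ l ∈ α.support, α l = 1) (p : ProdSph n)
    (u : ∀ m, EuclideanSpace ℝ (Fin (n m))) :
    ‖fderiv ℝ (chartMap f α p) 0 u‖ ^ 2 = dotProduct (vecG n α) (fun m => ‖u m‖ ^ 2) ∧
    ‖iteratedFDeriv ℝ 2 (chartMap f α p) 0 ![u, u]‖ ^ 2 =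
      dotProduct (fun m => ‖u m‖ ^ 2) ((matA n α).mulVec fun m => ‖u m‖ ^ 2) := by
  obtain ⟨ι, hι, h⟩ := exists_chartMap_eq p
  let q : ∀ m, EuclideanSpace ℝ (Fin (n m + 1)) := fun m => (p m).1
  let v : ∀ m, EuclideanSpace ℝ (Fin (n m + 1)) := fun m => ι m (u m)
  let c : ℝ → ∀ m, EuclideanSpace ℝ (Fin (n m + 1)) := fun t m => stereoLine (q m) (v m) t
  let c' : ℝ → ∀ m, EuclideanSpace ℝ (Fin (n m + 1)) := fun t m => stereoLineDeriv (q m) (v m) t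
  have hc : ∀ t, HasDerivAt c (c' t) t := fun t => by
    rw [hasDerivAt_pi]; exact fun m => hasDerivAt_stereoLine _ _ _
  have hc' : HasDerivAt c' (fun m => -(‖v m‖ ^ 2) • q m) 0 := by
    rw [hasDerivAt_pi]; exact fun m => hasDerivAt_stereoLineDeriv _ _
  have hc0 : c 0 = q := by ext1 m; simp [c, stereoLine]
  have hc'0 : c' 0 = v := by
    ext1 m
    simp only [c', stereoLineDeriv]
    norm_num
  have hcu : (fun t : ℝ => chartMap f α p (t • u)) = fun t => ambientMap f α (c t) := by
    ext1 t
    have e : stereoInv p ι (t • u) = c t := by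
      ext1 m
      simp [stereoInv, c, stereoLine, v, q, norm_smul, mul_pow]
    rw [chartMap_eq_ambientMap h, ← e]
  have hq : ContDiffAt ℝ ∞ (ambientMap f α) q :=
    contDiffAt_ambientMap hf fun m => ne_zero_of_mem_unit_sphere _
  have hq0 : ContDiffAt ℝ ∞ (ambientMap f α) (c 0) := by rwa [hc0]
  have hg0 : ContDiffAt ℝ ∞ (ambientMap f α) (geodesic q v 0) := by rwa [geodesic_zero]
  have key := norm_sq_iteratedDeriv_geodesic hn hf hα hα1 (p := q) (u := v) (fun m => by simp [q])
    (fun m => hι m (u m))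
  -- Both curves start at `q` with velocity `v` and acceleration -|v|² q, so the chain rule produces
  -- identical expressions.
  rw [(hasDerivAt_comp_curve hg0 (hasDerivAt_geodesic q v 0)).deriv,
    iteratedDeriv_two_comp_curve hg0 (hasDerivAt_geodesic q v) (hasDerivAt_geodesicDeriv q v),
    geodesic_zero, geodesicDeriv_zero] at key
  have hl := deriv_chartMap_line (α := α) hf p u
  rw [hcu, (hasDerivAt_comp_curve hq0 (hc 0)).deriv,
    iteratedDeriv_two_comp_curve hq0 hc hc', hc0, hc'0] at hl
  rw [← hl.1, ← hl.2]
  have hv : ∀ m, ‖v m‖ = ‖u m‖ := fun m => (ι m).norm_map _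
  simp only [hv] at key ⊢
  exact key

/-- The second derivative of `sumMap` in the preferred chart is normal. -/
theorem inner_fderiv_chartMap (hf : ∀ m l, IsOrthonormalEigenbasis (n m) l (f m l))
    (hα : ∀ l, 0 ≤ α l) (p : ProdSph n) (u v : ∀ m, EuclideanSpace ℝ (Fin (n m))) :
    inner ℝ (fderiv ℝ (chartMap f α p) 0 v) (iteratedFDeriv ℝ 2 (chartMap f α p) 0 ![u, u]) = 0 := by
  rw [← (deriv_chartMap_line hf p v).1, ← (deriv_chartMap_line hf p u).2]
  have hs : ∀ u : ∀ m, EuclideanSpace ℝ (Fin (n m)),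
      ContDiff ℝ ∞ fun t : ℝ => chartMap f α p (t • u) := fun u =>
    (contDiff_chartMap hf p).comp (contDiff_id.smul contDiff_const)
  refine inner_deriv_iteratedDeriv_eq_zero (hs v) (hs u) fun s t => ?_
  rw [neg_smul, neg_smul, inner_chartMap_neg hf hα]

lemma continuous_sumMap (hf : ∀ m l, IsOrthonormalEigenbasis (n m) l (f m l)) :
    Continuous (sumMap f α) := by
  refine (PiLp.continuous_toLp 2 _).comp (continuous_pi fun k => ?_)
  refine continuous_const.mul (continuous_finsetProd _ fun m _ => continuous_const.mul ?_)
  exact ((hf m _).continuous _).comp (continuous_apply m)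

lemma differential_sumMap (hf : ∀ m l, IsOrthonormalEigenbasis (n m) l (f m l)) (p : ProdSph n) :
    differential (prodModel n) (sumMap f α) p = fderiv ℝ (chartMap f α p) 0 := by
  have hw : writtenInExtChartAt (prodModel n) 𝓘(ℝ, Target n α) p (sumMap f α) =
    chartMap f α p := rfl
  have hd : DifferentiableAt ℝ (chartMap f α p) 0 :=
    (contDiff_chartMap hf p).differentiable (by simp) 0
  have hmd : MDifferentiableAt (prodModel n) 𝓘(ℝ, Target n α) (sumMap f α) p := by
    rw [mdifferentiableAt_iff]
    refine ⟨(continuous_sumMap hf).continuousAt, ?_⟩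
    rw [hw, extChartAt_prodSph_self]
    exact hd.differentiableWithinAt
  have h : fderivWithin ℝ (chartMap f α p) (Set.range (prodModel n))
      (extChartAt (prodModel n) p p) = fderiv ℝ (chartMap f α p) 0 := by
    rw [extChartAt_prodSph_self, range_prodModel, fderivWithin_univ]
  exact hmd.mfderiv.trans h

/-- The normal projection does nothing, because the second derivative at the centre of the chart is
already normal. -/
lemma secondFundamentalForm_sumMap (hf : ∀ m l, IsOrthonormalEigenbasis (n m) l (f m l))
    (hα : ∀ l, 0 ≤ α l) (p : ProdSph n) (u : ∀ m, EuclideanSpace ℝ (Fin (n m))) :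
    secondFundamentalForm (prodModel n) (sumMap f α) p u =
      iteratedFDeriv ℝ 2 (chartMap f α p) 0 ![u, u] := by
  rw [secondFundamentalForm, extChartAt_prodSph_self, range_prodModel, iteratedFDerivWithin_univ]
  refine Submodule.starProjection_eq_self_iff.2 ?_
  rw [Submodule.mem_orthogonal, differential_sumMap hf]
  rintro _ ⟨v, rfl⟩
  exact inner_fderiv_chartMap hf hα p u v

end Charts

/-! ### Immersions from injective differentials -/

section Immersion

/-- A finite product of manifolds is a manifold. -/
lemma isManifold_pi {ι : Type*} [Fintype ι] {E : ι → Type*} [∀ i, NormedAddCommGroup (E i)]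
    [∀ i, NormedSpace ℝ (E i)] {H : ι → Type*} [∀ i, TopologicalSpace (H i)]
    (I : ∀ i, ModelWithCorners ℝ (E i) (H i)) (k : WithTop ℕ∞) (X : ι → Type*)
    [∀ i, TopologicalSpace (X i)] [∀ i, ChartedSpace (H i) (X i)]
    [∀ i, IsManifold (I i) k (X i)] : IsManifold (ModelWithCorners.pi I) k (∀ i, X i) := by
  apply isManifold_of_contDiffOn
  rintro _ _ ⟨e, he, rfl⟩ ⟨e', he', rfl⟩
  rw [contDiffOn_pi]
  intro i
  have h := HasGroupoid.compatible (G := contDiffGroupoid k (I i)) (he i trivial) (he' i trivial)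
  have hproj : ContDiff ℝ k fun x : ∀ i, E i => x i :=
    (ContinuousLinearMap.proj (R := ℝ) (φ := E) i).contDiff
  refine ContDiffOn.comp (g := I i ∘ ((e i).symm ≫ₕ e' i) ∘ (I i).symm) h.1 hproj.contDiffOn ?_
  rintro x ⟨⟨hx1, hx2⟩, y, rfl⟩
  exact ⟨⟨hx1 i trivial, hx2 i trivial⟩, y i, rfl⟩

variable {E : Type*} [NormedAddCommGroup E] [NormedSpace ℝ E] [FiniteDimensional ℝ E]
  {V : Type*} [NormedAddCommGroup V] [InnerProductSpace ℝ V] [FiniteDimensional ℝ V]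

/-- An injective linear map extends to a linear equivalence from a product. -/
lemma exists_prod_equiv_of_injective (L : E →L[ℝ] V) (hL : Function.Injective L) :
    ∃ e : (E × EuclideanSpace ℝ (Fin (Module.finrank ℝ V - Module.finrank ℝ E))) ≃L[ℝ] V,
      ∀ x, e (x, 0) = L x := by
  let R : Submodule ℝ V := L.range
  have hR : Module.finrank ℝ R = Module.finrank ℝ E := LinearMap.finrank_range_of_inj hL
  have hsum := Submodule.finrank_add_finrank_orthogonal R
  let W := EuclideanSpace ℝ (Fin (Module.finrank ℝ V - Module.finrank ℝ E))
  have hW : Module.finrank ℝ W = Module.finrank ℝ Rᗮ := by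
    simp only [W, finrank_euclideanSpace_fin]
    omega
  let j : W ≃ₗ[ℝ] Rᗮ := LinearEquiv.ofFinrankEq _ _ hW
  let T : (E × W) →ₗ[ℝ] V := L.toLinearMap.coprod (Rᗮ.subtype ∘ₗ j.toLinearMap)
  have hT : Function.Injective T := by
    rw [← LinearMap.ker_eq_bot, LinearMap.ker_eq_bot']
    rintro ⟨x, w⟩ h
    have h' : L x + (j w : V) = 0 := h
    have h1 : L x ∈ R := ⟨x, rfl⟩
    have h2 : (j w : V) ∈ Rᗮ := (j w).2
    have h3 : (j w : V) ∈ R := by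
      rw [eq_neg_of_add_eq_zero_right h']; exact R.neg_mem h1
    have h4 : (j w : V) = 0 := by
      have := Submodule.mem_orthogonal R (j w) |>.1 h2 _ h3
      exact inner_self_eq_zero.1 this
    rw [h4, add_zero] at h'
    have hx : x = 0 := hL (by rw [h', map_zero])
    have hw : w = 0 := j.injective (by ext1; rw [h4]; simp)
    rw [hx, hw]; rfl
  have hdim : Module.finrank ℝ (E × W) = Module.finrank ℝ V := by
    rw [Module.finrank_prod, hW, ← hR, hsum]
  let e := (LinearEquiv.ofInjectiveOfFinrankEq T hT hdim).toContinuousLinearEquiv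
  refine ⟨e, fun x => ?_⟩
  have : e (x, 0) = T (x, 0) := rfl
  rw [this]
  simp [T]

/-- The inverse function theorem with a smooth local inverse. -/
lemma exists_openPartialHomeomorph {E₁ E₂ : Type*} [NormedAddCommGroup E₁] [NormedSpace ℝ E₁]
    [CompleteSpace E₁] [NormedAddCommGroup E₂] [NormedSpace ℝ E₂] {Φ : E₁ → E₂}
    (hΦ : ContDiff ℝ ∞ Φ) (e : E₁ ≃L[ℝ] E₂) {z : E₁} (he : fderiv ℝ Φ z = e) :
    ∃ ψ : OpenPartialHomeomorph E₁ E₂, ψ = Φ ∧ z ∈ ψ.source ∧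
      ContDiffOn ℝ ∞ ψ.symm ψ.target := by
  have hd : ∀ y, HasFDerivAt Φ (fderiv ℝ Φ y) y := fun y =>
    (hΦ.differentiable (by simp) y).hasFDerivAt
  have hz : HasFDerivAt Φ (e : E₁ →L[ℝ] E₂) z := he ▸ hd z
  let ψ₀ := hΦ.contDiffAt.toOpenPartialHomeomorph Φ hz (by simp)
  -- Restricting to the open set where the derivative is invertible makes the inverse smooth on the
  -- whole target, not only at one point.
  let S : Set E₁ := fderiv ℝ Φ ⁻¹' Set.range ((↑) : (E₁ ≃L[ℝ] E₂) → E₁ →L[ℝ] E₂)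
  have hS : IsOpen S := ContinuousLinearEquiv.isOpen.preimage (hΦ.continuous_fderiv (by simp))
  let ψ := ψ₀.restrOpen S hS
  have hψ : (ψ : E₁ → E₂) = Φ := rfl
  refine ⟨ψ, hψ, ⟨hΦ.contDiffAt.mem_toOpenPartialHomeomorph_source hz (by simp), e, he.symm⟩, ?_⟩
  intro y hy
  obtain ⟨e', he'⟩ : ψ.symm y ∈ S := (ψ.map_target hy).2
  have h1 : HasFDerivAt ψ (e' : E₁ →L[ℝ] E₂) (ψ.symm y) := by
    rw [he', hψ]; exact hd _
  exact (ψ.contDiffAt_symm hy h1 (by rw [hψ]; exact hΦ.contDiffAt)).contDiffWithinAt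

/-- A map with injective differential which is smooth in charts is an immersion. -/
theorem isImmersion_of_injective_fderiv {H : Type*} [TopologicalSpace H]
    {I : ModelWithCorners ℝ E H}
    {X : Type*} [TopologicalSpace X] [ChartedSpace H X] [IsManifold I ∞ X] {F : X → V}
    (hF : ∀ p, ContDiff ℝ ∞ (F ∘ (extChartAt I p).symm))
    (hinj : ∀ p, Function.Injective (fderiv ℝ (F ∘ (extChartAt I p).symm) (extChartAt I p p))) :
    IsImmersion I 𝓘(ℝ, V) ∞ F := by
  refine IsImmersionOfComplement.isImmersion (F := EuclideanSpace ℝ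
    (Fin (Module.finrank ℝ V - Module.finrank ℝ E))) fun p => ?_
  set g := F ∘ (extChartAt I p).symm with hg
  obtain ⟨e, he⟩ := exists_prod_equiv_of_injective _ (hinj p)
  set x₀ := extChartAt I p p with hx₀
  let W := EuclideanSpace ℝ (Fin (Module.finrank ℝ V - Module.finrank ℝ E))
  let ι : W →L[ℝ] V := (e : (E × W) →L[ℝ] V).comp (ContinuousLinearMap.inr ℝ E W)
  -- The map is thickened by a complement of the tangent space, so that the inverse function theorem
  -- applies at `(x₀, 0)`.
  let Φ : E × W → V := fun z => g z.1 + ι z.2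
  have hΦ : ContDiff ℝ ∞ Φ :=
    ((hF p).comp contDiff_fst).add (ι.contDiff.comp contDiff_snd)
  have hΦ' : fderiv ℝ Φ (x₀, 0) = e := by
    have h1 : HasFDerivAt (fun z : E × W => g z.1)
        ((fderiv ℝ g x₀).comp (ContinuousLinearMap.fst ℝ E W)) (x₀, 0) :=
      HasFDerivAt.comp (x₀, (0 : W)) (g := g) (f := Prod.fst)
        (((hF p).differentiable (by simp) x₀).hasFDerivAt) hasFDerivAt_fst
    have h2 : HasFDerivAt (fun z : E × W => ι z.2)
        (ι.comp (ContinuousLinearMap.snd ℝ E W)) (x₀, 0) :=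
      ι.hasFDerivAt.comp (x₀, (0 : W)) hasFDerivAt_snd
    refine (h1.add h2).fderiv.trans ?_
    refine ContinuousLinearMap.ext fun z => ?_
    have : z = (z.1, 0) + (0, z.2) := by simp
    conv_rhs => rw [this]
    change fderiv ℝ g x₀ z.1 + e (0, z.2) = e ((z.1, 0) + (0, z.2))
    rw [map_add, he]
  obtain ⟨ψ, hψ, hmem, hsm⟩ := exists_openPartialHomeomorph hΦ e hΦ'
  -- Straightening by the inverse of `Φ` turns F into the linear inclusion x ↦ e(x, 0).
  let cod : OpenPartialHomeomorph V V := ψ.symm.transHomeomorph e.toHomeomorph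
  let D : Set E := (fun x : E => ((x, 0) : E × W)) ⁻¹' ψ.source
  have hD : IsOpen D := ψ.open_source.preimage (by fun_prop)
  let dom : OpenPartialHomeomorph X H := (chartAt H p).restr
    ((extChartAt I p).source ∩ extChartAt I p ⁻¹' D)
  have hopen : IsOpen ((extChartAt I p).source ∩ extChartAt I p ⁻¹' D) :=
    (continuousOn_extChartAt p).isOpen_inter_preimage (isOpen_extChartAt_source p) hD
  have hdom : dom.source = (extChartAt I p).source ∩ extChartAt I p ⁻¹' D := by
    simp only [dom, OpenPartialHomeomorph.restr_source' _ _ hopen]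
    rw [extChartAt_source]
    exact Set.inter_eq_right.2 Set.inter_subset_left
  have hFψ : ∀ y ∈ dom.source, F y = ψ (extChartAt I p y, 0) := fun y hy => by
    rw [hdom] at hy
    simp only [hψ, Φ, map_zero, add_zero, hg, Function.comp_apply]
    rw [(extChartAt I p).left_inv hy.1]
  have hsub : dom.source ⊆ F ⁻¹' cod.source := fun y hy => by
    have : cod.source = ψ.target := rfl
    rw [Set.mem_preimage, this, hFψ y hy]
    rw [hdom] at hy
    exact ψ.map_source hy.2
  have hp : p ∈ dom.source := by
    rw [hdom]
    exact ⟨mem_extChartAt_source p, hmem⟩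
  refine IsImmersionAtOfComplement.mk_of_charts e dom cod hp (hsub hp) ?_ ?_ hsub ?_
  · exact restr_mem_maximalAtlas _ (IsManifold.chart_mem_maximalAtlas p) hopen
  · apply OpenPartialHomeomorph.mem_maximalAtlas_of_contMDiffOn
    · rw [contMDiffOn_iff_contDiffOn]
      exact e.contDiff.comp_contDiffOn hsm
    · rw [contMDiffOn_iff_contDiffOn]
      have : (cod.symm : V → V) = Φ ∘ e.symm := by rw [← hψ]; rfl
      rw [this]
      exact (hΦ.comp e.symm.contDiff).contDiffOn
  · intro y hy
    have hy' : (dom.extend I).symm y ∈ dom.source := by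
      have := (dom.extend I).map_target hy
      rwa [OpenPartialHomeomorph.extend_source] at this
    have h1 : cod (F ((dom.extend I).symm y)) = e (extChartAt I p ((dom.extend I).symm y), 0) := by
      rw [hFψ _ hy']
      rw [hdom] at hy'
      have : cod (ψ (extChartAt I p ((dom.extend I).symm y), 0)) =
        e (ψ.symm (ψ (extChartAt I p ((dom.extend I).symm y), 0))) := rfl
      rw [this, ψ.left_inv hy'.2]
    have h2 : extChartAt I p ((dom.extend I).symm y) = y := (dom.extend I).right_inv hy
    change cod (F ((dom.extend I).symm y)) = e (y, 0)
    rw [h1, h2]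

end Immersion

/-! ### Copositivity of B(s) -/

section Copositive

variable {M : ℕ} {n : Fin M → ℕ} {α : (Fin M → ℕ) →₀ ℝ}

lemma isCopositive_matB_iff (s : ℝ) : IsCopositive (matB n α s) ↔
    ∀ U : Fin M → ℝ, (∀ m, 0 ≤ U m) →
      dotProduct U ((matA n α).mulVec U) ≤ s * dotProduct (vecG n α) U ^ 2 := by
  have hsymm : (matB n α s).IsSymm := by
    ext a b
    simp only [matB, matA, Matrix.transpose_apply, Matrix.sub_apply, Matrix.smul_apply,
      Matrix.vecMulVec_apply, Matrix.of_apply, smul_eq_mul]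
    by_cases h : a = b
    · subst h; rfl
    · simp [h, Ne.symm h, mul_comm]
  have hform : ∀ U : Fin M → ℝ, dotProduct U ((matB n α s).mulVec U) =
      s * dotProduct (vecG n α) U ^ 2 - dotProduct U ((matA n α).mulVec U) := fun U => by
    rw [matB, Matrix.sub_mulVec, dotProduct_sub, Matrix.smul_mulVec, dotProduct_smul,
      Matrix.vecMulVec_mulVec, dotProduct_smul]
    simp only [smul_eq_mul, MulOpposite.smul_eq_mul_unop, MulOpposite.unop_op]
    rw [dotProduct_comm U]
    ring
  constructor
  · rintro ⟨-, h⟩ U hU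
    have := h U hU
    rw [hform] at this
    linarith
  · intro h
    refine ⟨hsymm, fun U hU => ?_⟩
    rw [hform]
    linarith [h U hU]

/-- There is a smallest `s ≥ 0` for which `matB n α s` is copositive. -/
lemma exists_isLeast_copositive (hG : ∀ m, 0 < vecG n α m) :
    ∃ s, IsLeast {s : ℝ | 0 ≤ s ∧ IsCopositive (matB n α s)} s := by
  set S := {s : ℝ | 0 ≤ s ∧ IsCopositive (matB n α s)} with hS
  -- An intersection of closed conditions on s, so the infimum is attained once the set is nonempty.
  have hSeq : S = Set.Ici 0 ∩ ⋂ (U : Fin M → ℝ) (_ : ∀ m, 0 ≤ U m),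
      {s | dotProduct U ((matA n α).mulVec U) ≤ s * dotProduct (vecG n α) U ^ 2} := by
    ext s
    simp [hS, isCopositive_matB_iff]
  have hclosed : IsClosed S := by
    rw [hSeq]
    refine isClosed_Ici.inter (isClosed_iInter fun U => isClosed_iInter fun _ => ?_)
    exact isClosed_le continuous_const (continuous_id.mul continuous_const)
  have hne : S.Nonempty := by
    -- Each term satisfies A_ab U_a U_b ≤ |A_ab| / (G_a G_b) · (G·U)², since G_m U_m ≤ G·U for every
    -- m.
    refine ⟨∑ a, ∑ b, |matA n α a b| / (vecG n α a * vecG n α b), ?_,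
      (isCopositive_matB_iff _).2 fun U hU => ?_⟩
    · exact Finset.sum_nonneg fun a _ => Finset.sum_nonneg fun b _ =>
        div_nonneg (abs_nonneg _) (mul_pos (hG a) (hG b)).le
    · simp only [dotProduct, Matrix.mulVec]
      rw [Finset.sum_mul]
      refine Finset.sum_le_sum fun a _ => ?_
      rw [Finset.mul_sum, Finset.sum_mul]
      refine Finset.sum_le_sum fun b _ => ?_
      have h0 : ∀ m, 0 ≤ vecG n α m * U m := fun m => mul_nonneg (hG m).le (hU m)
      have hle : ∀ m, vecG n α m * U m ≤ ∑ m, vecG n α m * U m := fun m =>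
        Finset.single_le_sum (fun m _ => h0 m) (Finset.mem_univ m)
      have h1 : (vecG n α a * U a) * (vecG n α b * U b) ≤ (∑ m, vecG n α m * U m) ^ 2 := by
        rw [sq]
        exact mul_le_mul (hle a) (hle b) (h0 b) ((h0 a).trans (hle a))
      have h2 : U a * (matA n α a b * U b) ≤
          |matA n α a b| / (vecG n α a * vecG n α b) *
            ((vecG n α a * U a) * (vecG n α b * U b)) := by
        have e : |matA n α a b| / (vecG n α a * vecG n α b) *
            ((vecG n α a * U a) * (vecG n α b * U b)) = U a * (|matA n α a b| * U b) := by
          have := (hG a).ne'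
          have := (hG b).ne'
          field_simp
        rw [e]
        exact mul_le_mul_of_nonneg_left (mul_le_mul_of_nonneg_right (le_abs_self _) (hU b)) (hU a)
      exact h2.trans (mul_le_mul_of_nonneg_left h1
        (div_nonneg (abs_nonneg _) (mul_pos (hG a) (hG b)).le))
  exact ⟨sInf S, hclosed.csInf_mem hne ⟨0, fun s hs => hs.1⟩,
    fun s hs => csInf_le ⟨0, fun s hs => hs.1⟩ hs⟩

end Copositive

/-! ### The immersion property and the value of the normal curvature -/

section Main

variable {M : ℕ} {n : Fin M → ℕ}

instance isManifold_prodSph : IsManifold (prodModel n) ∞ (ProdSph n) :=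
  have : ∀ m, IsManifold (𝓡 (n m)) ∞ (Sph (n m)) := fun _ => inferInstance
  isManifold_pi (fun m => 𝓡 (n m)) ∞ fun m => Sph (n m)

variable {f : ∀ m l, Fin (eigenDim (n m) l) → Sph (n m) → ℝ} {α : (Fin M → ℕ) →₀ ℝ}

/-- The pullback metric is ∑ G_m |u_m|², which is definite since every G_m is positive. -/
theorem isImmersion_sumMap (hn : ∀ m, 1 ≤ n m)
    (hf : ∀ m l, IsOrthonormalEigenbasis (n m) l (f m l))
    (hα : ∀ l, 0 ≤ α l) (hα1 : ∑ l ∈ α.support, α l = 1) (hG : ∀ m, 0 < vecG n α m) :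
    IsImmersion (prodModel n) 𝓘(ℝ, Target n α) ∞ (sumMap f α) := by
  refine isImmersion_of_injective_fderiv (fun p => contDiff_chartMap hf p) fun p => ?_
  rw [extChartAt_prodSph_self, injective_iff_map_eq_zero]
  intro u hu
  have h := (norm_sq_fderiv_chartMap hn hf hα hα1 p u).1
  have hu' : fderiv ℝ (chartMap f α p) 0 u = 0 := hu
  rw [hu', norm_zero, zero_pow two_ne_zero, dotProduct] at h
  have h0 := (Finset.sum_eq_zero_iff_of_nonneg fun m _ =>
    mul_nonneg (hG m).le (sq_nonneg ‖u m‖)).1 h.symm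
  ext1 m
  have := h0 m (Finset.mem_univ m)
  simpa [(hG m).ne'] using this

/-- The vectors (|u_m|²) of unit tangent vectors are exactly the U ≥ 0 with G·U = 1. Copositivity of
B(s) bounds |𝐀|² by s; conversely the square of a finite supremum makes B copositive, so minimality
of s applies. -/
lemma normalCurvature_sumMap (hn : ∀ m, 1 ≤ n m)
    (hf : ∀ m l, IsOrthonormalEigenbasis (n m) l (f m l))
    (hα : ∀ l, 0 ≤ α l) (hα1 : ∑ l ∈ α.support, α l = 1) (hG : ∀ m, 0 < vecG n α m) {s : ℝ}
    (hs : IsLeast {s : ℝ | 0 ≤ s ∧ IsCopositive (matB n α s)} s) :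
    normalCurvature (prodModel n) (sumMap f α) = ENNReal.ofReal √s := by
  have hforms := fun p u => norm_sq_fderiv_chartMap hn hf hα hα1 p u
  apply le_antisymm
  · refine iSup_le fun p => iSup_le fun u => iSup_le fun hu => ?_
    rw [differential_sumMap hf] at hu
    rw [secondFundamentalForm_sumMap hf hα, ← ofReal_norm]
    apply ENNReal.ofReal_le_ofReal
    apply Real.le_sqrt_of_sq_le
    have h1 := (hforms p u).1
    rw [hu, one_pow] at h1
    rw [(hforms p u).2]
    have := (isCopositive_matB_iff s).1 hs.1.2 (fun m => ‖u m‖ ^ 2) fun m => sq_nonneg _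
    rwa [← h1, one_pow, mul_one] at this
  · by_cases htop : normalCurvature (prodModel n) (sumMap f α) = ⊤
    · rw [htop]; exact le_top
    set C := (normalCurvature (prodModel n) (sumMap f α)).toReal with hC
    have hC0 : 0 ≤ C := ENNReal.toReal_nonneg
    have hle : ∀ p u, ‖fderiv ℝ (chartMap f α p) 0 u‖ = 1 →
        ‖iteratedFDeriv ℝ 2 (chartMap f α p) 0 ![u, u]‖ ≤ C := fun p u hu => by
      rw [hC, ← ENNReal.ofReal_le_iff_le_toReal htop, ofReal_norm,
        ← secondFundamentalForm_sumMap hf hα]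
      refine le_iSup_of_le p (le_iSup_of_le u (le_iSup_of_le ?_ le_rfl))
      rw [differential_sumMap hf]
      exact hu
    have hmem : C ^ 2 ∈ {s : ℝ | 0 ≤ s ∧ IsCopositive (matB n α s)} := by
      refine ⟨sq_nonneg C, (isCopositive_matB_iff _).2 fun U hU => ?_⟩
      have h0 : ∀ m, 0 ≤ vecG n α m * U m := fun m => mul_nonneg (hG m).le (hU m)
      have hnn : 0 ≤ dotProduct (vecG n α) U := Finset.sum_nonneg fun m _ => h0 m
      rcases hnn.eq_or_lt with hz | hpos
      · have hU0 : U = 0 := by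
          ext1 m
          have := (Finset.sum_eq_zero_iff_of_nonneg fun m _ => h0 m).1 hz.symm m (Finset.mem_univ m)
          simpa [(hG m).ne'] using this
        simp [hU0]
      · set g := dotProduct (vecG n α) U with hg
        have p : ProdSph n := fun m => ⟨EuclideanSpace.single 0 1, by simp⟩
        -- A unit tangent vector with |u_m|² = U_m / (G·U). Its coordinate 0 exists because each
        -- sphere has dimension at least 1; the point `p` is arbitrary.
        let u : ∀ m, EuclideanSpace ℝ (Fin (n m)) := fun m =>
          EuclideanSpace.single ⟨0, hn m⟩ √(U m / g)
        have hu : (fun m => ‖u m‖ ^ 2) = g⁻¹ • U := by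
          ext1 m
          simp only [u, PiLp.norm_single, Real.norm_eq_abs, sq_abs, Pi.smul_apply,
            smul_eq_mul]
          rw [Real.sq_sqrt (div_nonneg (hU m) hpos.le), div_eq_inv_mul]
        obtain ⟨h1, h2⟩ := hforms p u
        rw [hu, dotProduct_smul, ← hg, smul_eq_mul, inv_mul_cancel₀ hpos.ne'] at h1
        rw [hu, Matrix.mulVec_smul, dotProduct_smul, smul_dotProduct, smul_eq_mul,
          smul_eq_mul] at h2
        have h3 := hle p u ((pow_eq_one_iff_of_nonneg (norm_nonneg _) two_ne_zero).1 h1)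
        have h4 : g⁻¹ * (g⁻¹ * dotProduct U ((matA n α).mulVec U)) ≤ C ^ 2 := by
          rw [← h2]
          exact pow_le_pow_left₀ (norm_nonneg _) h3 2
        rw [← mul_assoc, ← sq, inv_pow, inv_mul_le_iff₀ (by positivity)] at h4
        linarith
    rw [ENNReal.ofReal_le_iff_le_toReal htop, ← hC]
    exact Real.sqrt_le_iff.2 ⟨hC0, hs.2 hmem⟩

end Main

end VeroneseProduct

end

theorem proposition3p1 {M : ℕ} (n : Fin M → ℕ) (hn : ∀ m, 1 ≤ n m)
    (f : ∀ m l, Fin (VeroneseProduct.eigenDim (n m) l) → VeroneseProduct.Sph (n m) → ℝ)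
    (hf : ∀ m l, VeroneseProduct.IsOrthonormalEigenbasis (n m) l (f m l))
    (α : (Fin M → ℕ) →₀ ℝ) (hα : ∀ l, 0 ≤ α l) (hα1 : ∑ l ∈ α.support, α l = 1)
    (hρ : ∀ m, 0 < VeroneseProduct.expect α fun l => VeroneseProduct.rho (n m) (l m)) :
    (∀ x, ‖VeroneseProduct.sumMap f α x‖ = 1) ∧
    Manifold.IsImmersion (VeroneseProduct.prodModel n) 𝓘(ℝ, VeroneseProduct.Target n α) ∞
      (VeroneseProduct.sumMap f α) ∧
    ∃ s : ℝ, IsLeast {s : ℝ | 0 ≤ s ∧ VeroneseProduct.IsCopositive (VeroneseProduct.matB n α s)} s ∧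
      VeroneseProduct.normalCurvature (VeroneseProduct.prodModel n)
        (VeroneseProduct.sumMap f α) = ENNReal.ofReal √s := by
  obtain ⟨s, hs⟩ := VeroneseProduct.exists_isLeast_copositive hρ
  exact ⟨VeroneseProduct.norm_sumMap hn hf hα hα1,
    VeroneseProduct.isImmersion_sumMap hn hf hα hα1 hρ, s, hs,
    VeroneseProduct.normalCurvature_sumMap hn hf hα hα1 hρ hs⟩
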